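/- All spaces are over a fixed scalar field $\mathbb F\in\{\mathbb R,\mathbb C\}$. A \emph{quasi-Banach space} is a vector space with a quasi-norm (a map $\|\cdot\|\ge 0$ that vanishes only at $0$, is absolutely homogeneous, and satisfies $\|f+g\|\le\kappa(\|f\|+\|g\|)$ for some constant $\kappa\ge 1$) whose induced vector topology is complete. $\simeq$ denotes linear homeomorphism, and $X\oplus Y$ is the Cartesian product with the quasi-norm $\max\{\|x\|,\|y\|\}$. The \emph{Banach envelope} of a quasi-Banach space $X$ is the Banach space $\widehat X$ together with a linear contraction $J_X\colon X\to\widehat X$ such that every linear contraction $T$ from $X$ into a Banach space factors uniquely as $T=\widehat T\circ J_X$ with $\widehat T$ a linear contraction. A subspace is \emph{complemented} if it is the range of a bounded linear projection. A countable family $(b_n)_{n\in N}$ is an \emph{unconditional basis} of $X$ if its closed linear span is $X$ and every $f\in X$ has a unique unconditionally convergent expansion $f=\sum_{n\in N}a_nb_n$; $[b_n\colon n\in A]$ denotes the closed linear span of $(b_n)_{n\in A}$. Let $X,Y$ be quasi-Banach spaces. \begin{itemize} \item $(X,Y)$ is \emph{splitting for unconditional bases} if for every unconditional basis $(b_n)_{n\in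 N}$ of $X\oplus Y$ there is $A\subseteq N$ with $[b_n\colon n\in A]\simeq X$ and $[b_n\colon n\in N\setminus A]\simeq Y$. \item $(X,Y)$ is \emph{splitting for complemented subspaces} if for every complemented subspace $V$ of $X\oplus Y$ there are complemented subspaces $V_1$ of $X$ and $V_2$ of $Y$ and an automorphism $T$ of $X\oplus Y$ with $T(V)=V_1\oplus V_2$. \item $X$ and $Y$ are \emph{complementably incomparable} if no infinite-dimensional quasi-Banach space is isomorphic both to a complemented subspace of $X$ and to a complemented subspace of $Y$. \item A quasi-Banach lattice $L$ is \emph{$L$-convex} if there is $\varepsilon>0$ such that whenever $k\ge1$, $0\le f_i\le f$ for $1\le i\le k$ and $\sum_{i=1}^kf_i\ge(1-\varepsilon)kf$, then $\max_i\|f_i\|\ge\varepsilon\|f\|$. A quasi-Banach space is \emph{natural} if it is isomorphic to a subspace of an $L$-convex quasi-Banach lattice. \item A Banach space $U$ is a \emph{proper envelope} (resp. a \emph{proper envelope of a natural space}) if there is a quasi-Banach space (resp. a natural quasi-Banach space) $Z$ that is not locally convex, whose dual $Z^*$ separates the points of $Z$, and whose Banach envelope satisfies $\widehat Z\simeq U$.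 \end{itemize} \textbf{Lemma.} Let $X$ be a quasi-Banach space and $U$ a Banach space. Suppose that \begin{enumerate} \item[(i)] $(X,U)$ is splitting for complemented subspaces; \item[(ii)] $(\widehat X,U)$ is splitting for unconditional bases; \item[(iii)] $\widehat X$ and $U$ are complementably incomparable; and \item[(iv)] either $U$ is not a proper envelope, or $X$ is natural and $U$ is not a proper envelope of a natural space. \end{enumerate} Then $(X,U)$ is splitting for unconditional bases. -/

import Mathlib

open Filter Topology

universe u v w

/-- A quasi-Banach space over `𝕜 = ℝ` or `ℂ`: a topological vector space whose topology is given by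
a complete quasi-norm. -/
class QuasiBanachSpace (𝕜 : Type*) (X : Type*) [RCLike 𝕜] [AddCommGroup X] [Module 𝕜 X]
    [TopologicalSpace X] [IsTopologicalAddGroup X] [ContinuousSMul 𝕜 X] where
  /-- The quasi-norm. -/
  qnorm : X → ℝ
  qnorm_nonneg : ∀ x, 0 ≤ qnorm x
  qnorm_eq_zero : ∀ x, qnorm x = 0 ↔ x = 0
  qnorm_smul : ∀ (a : 𝕜) (x : X), qnorm (a • x) = ‖a‖ * qnorm x
  exists_modulus : ∃ κ : ℝ, 1 ≤ κ ∧ ∀ x y, qnorm (x + y) ≤ κ * (qnorm x + qnorm y)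
  nhds_zero_basis : (𝓝 (0 : X)).HasBasis (fun ε : ℝ => 0 < ε) (fun ε => {x | qnorm x < ε})
  complete : ∀ s : ℕ → X,
    (∀ ε : ℝ, 0 < ε → ∃ N, ∀ m, N ≤ m → ∀ n, N ≤ n → qnorm (s m - s n) < ε) →
      ∃ x, Tendsto s atTop (𝓝 x)

/-! ### The Banach envelope -/

noncomputable section Envelope

variable (𝕜 : Type*) (X : Type*) [RCLike 𝕜] [AddCommGroup X] [Module 𝕜 X]
  [TopologicalSpace X] [IsTopologicalAddGroup X] [ContinuousSMul 𝕜 X] [QuasiBanachSpace 𝕜 X]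

/-- The largest seminorm dominated by the quasi-norm (that is, the Minkowski functional of the
convex hull of the unit ball). -/
def envelopeSeminorm : Seminorm 𝕜 X :=
  sSup {p : Seminorm 𝕜 X | ∀ x, p x ≤ QuasiBanachSpace.qnorm 𝕜 x}

/-- The vector space `X`, regarded as a seminormed space with the envelope seminorm. -/
@[nolint unusedArguments]
def PreEnvelope (_𝕜 : Type*) (X : Type*) : Type _ := X

instance : AddCommGroup (PreEnvelope 𝕜 X) := inferInstanceAs (AddCommGroup X)

instance : Module 𝕜 (PreEnvelope 𝕜 X) := inferInstanceAs (Module 𝕜 X)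

instance : SeminormedAddCommGroup (PreEnvelope 𝕜 X) :=
  AddGroupSeminorm.toSeminormedAddCommGroup (E := PreEnvelope 𝕜 X)
    (envelopeSeminorm 𝕜 X).toAddGroupSeminorm

instance : NormedSpace 𝕜 (PreEnvelope 𝕜 X) where
  norm_smul_le a x := (map_smul_eq_mul (envelopeSeminorm 𝕜 X) a x).le

/-- The Banach envelope: the (Hausdorff) completion of `X` under the envelope seminorm. -/
abbrev BanachEnvelope : Type _ := UniformSpace.Completion (PreEnvelope 𝕜 X)

/-- The envelope map `J : X → X̂`. -/
def envelopeMap : X →ₗ[𝕜] BanachEnvelope 𝕜 X :=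
  (UniformSpace.Completion.toComplₗᵢ (𝕜 := 𝕜) (E := PreEnvelope 𝕜 X)).toLinearMap

variable {𝕜 X}

theorem envelopeSeminorm_bddAbove :
    BddAbove {p : Seminorm 𝕜 X | ∀ x, p x ≤ QuasiBanachSpace.qnorm 𝕜 x} := by
  rw [Seminorm.bddAbove_iff]
  refine ⟨QuasiBanachSpace.qnorm 𝕜, ?_⟩
  rintro _ ⟨p, hp, rfl⟩ x
  exact hp x

theorem norm_envelopeMap (x : X) : ‖envelopeMap 𝕜 X x‖ = envelopeSeminorm 𝕜 X x :=
  (UniformSpace.Completion.toComplₗᵢ (𝕜 := 𝕜) (E := PreEnvelope 𝕜 X)).norm_map x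

/-- The envelope map is a contraction. -/
theorem norm_envelopeMap_le (x : X) : ‖envelopeMap 𝕜 X x‖ ≤ QuasiBanachSpace.qnorm 𝕜 x := by
  rw [norm_envelopeMap, envelopeSeminorm, Seminorm.sSup_apply envelopeSeminorm_bddAbove]
  exact Real.iSup_le (fun p => p.2 x) (QuasiBanachSpace.qnorm_nonneg x)

/-- The universal property of the Banach envelope. -/
theorem existsUnique_envelope_lift {Y : Type*} [NormedAddCommGroup Y] [NormedSpace 𝕜 Y]
    [CompleteSpace Y] (T : X →ₗ[𝕜] Y) (hT : ∀ x, ‖T x‖ ≤ QuasiBanachSpace.qnorm 𝕜 x) :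
    ∃! S : BanachEnvelope 𝕜 X →ₗ[𝕜] Y,
      (∀ z, ‖S z‖ ≤ ‖z‖) ∧ ∀ x, S (envelopeMap 𝕜 X x) = T x := by
  have hle : ∀ x, ‖T x‖ ≤ envelopeSeminorm 𝕜 X x := fun x =>
    le_csSup envelopeSeminorm_bddAbove
      (show (normSeminorm 𝕜 Y).comp T ∈ _ from hT) x
  let T' : PreEnvelope 𝕜 X →L[𝕜] Y :=
    LinearMap.mkContinuous (show PreEnvelope 𝕜 X →ₗ[𝕜] Y from T) 1
      (fun x => (hle x).trans_eq (one_mul _).symm)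
  let J : PreEnvelope 𝕜 X →L[𝕜] BanachEnvelope 𝕜 X := UniformSpace.Completion.toComplL
  have hd : DenseRange J := UniformSpace.Completion.denseRange_coe
  have hJ : IsUniformInducing J := UniformSpace.Completion.isUniformInducing_coe _
  have hext : ∀ x, T'.extend J (J x) = T' x := fun x => T'.extend_eq hd hJ x
  refine ⟨(T'.extend J).toLinearMap, ⟨fun z => ?_, fun x => hext x⟩, ?_⟩
  · refine hd.induction_on (p := fun z => ‖T'.extend J z‖ ≤ ‖z‖) z
      (isClosed_le (T'.extend J).continuous.norm continuous_norm) fun x => ?_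
    rw [hext]
    exact (hle x).trans_eq (norm_envelopeMap (X := X) x).symm
  · rintro S ⟨hS, hSJ⟩
    have hc : Continuous S :=
      AddMonoidHomClass.continuous_of_bound S 1 fun z => by simpa using hS z
    refine LinearMap.ext fun z => congrFun (hd.equalizer hc (T'.extend J).continuous ?_) z
    funext x
    exact (hSJ x).trans (hext x).symm

end Envelope

/-! ### Bases, splitting and incomparability -/

section Splitting

/-- The closed linear span `[b n : n ∈ A]`. -/
abbrev closedSpan (𝕜 : Type*) {X ι : Type*} [RCLike 𝕜] [AddCommGroup X] [Module 𝕜 X]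
    [TopologicalSpace X] [IsTopologicalAddGroup X] [ContinuousSMul 𝕜 X]
    (b : ι → X) (A : Set ι) : Submodule 𝕜 X :=
  (Submodule.span 𝕜 (b '' A)).topologicalClosure

/-- A countable family `b` is an unconditional basis of `X` if its closed linear span is `X` and
every vector has a unique unconditionally convergent expansion `∑ a n • b n`. -/
structure IsUnconditionalBasis (𝕜 : Type*) {X ι : Type*} [RCLike 𝕜] [AddCommGroup X] [Module 𝕜 X]
    [TopologicalSpace X] [IsTopologicalAddGroup X] [ContinuousSMul 𝕜 X] (b : ι → X) : Prop where
  countable : Countable ι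
  closedSpan_eq_top : closedSpan 𝕜 b Set.univ = ⊤
  existsUnique_hasSum : ∀ f : X, ∃! a : ι → 𝕜, HasSum (fun n => a n • b n) f

variable (𝕜 : Type*) (X Y : Type*) [RCLike 𝕜]
  [AddCommGroup X] [Module 𝕜 X] [TopologicalSpace X] [IsTopologicalAddGroup X] [ContinuousSMul 𝕜 X]
  [AddCommGroup Y] [Module 𝕜 Y] [TopologicalSpace Y] [IsTopologicalAddGroup Y] [ContinuousSMul 𝕜 Y]

/-- The pair `(X, Y)` is splitting for unconditional bases. (Every countable index set is in
bijection with one in `Type`.) -/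
def SplittingForUnconditionalBases : Prop :=
  ∀ (ι : Type) (b : ι → X × Y), IsUnconditionalBasis 𝕜 b →
    ∃ A : Set ι, Nonempty (closedSpan 𝕜 b A ≃L[𝕜] X) ∧ Nonempty (closedSpan 𝕜 b Aᶜ ≃L[𝕜] Y)

/-- The pair `(X, Y)` is splitting for complemented subspaces. -/
def SplittingForComplementedSubspaces : Prop :=
  ∀ V : Submodule 𝕜 (X × Y), V.ClosedComplemented →
    ∃ (V₁ : Submodule 𝕜 X) (V₂ : Submodule 𝕜 Y) (T : (X × Y) ≃L[𝕜] (X × Y)),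
      V₁.ClosedComplemented ∧ V₂.ClosedComplemented ∧
        V.map (T : (X × Y) →ₗ[𝕜] (X × Y)) = V₁.prod V₂

/-- `X` and `Y` are complementably incomparable: isomorphic complemented subspaces of `X` and `Y`
are finite-dimensional. -/
def ComplementablyIncomparable : Prop :=
  ∀ (V : Submodule 𝕜 X) (W : Submodule 𝕜 Y), V.ClosedComplemented → W.ClosedComplemented →
    Nonempty (V ≃L[𝕜] W) → FiniteDimensional 𝕜 V

end Splitting

/-! ### Natural spaces and proper envelopes -/

/-- The real vector space underlying a vector space over `𝕜 = ℝ` or `ℂ`. -/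
abbrev realModule (𝕜 : Type*) (X : Type*) [RCLike 𝕜] [AddCommGroup X] [Module 𝕜 X] : Module ℝ X :=
  Module.compHom X (algebraMap ℝ 𝕜)

/-- Local convexity of a topological vector space over `𝕜 = ℝ` or `ℂ`. -/
def IsLocallyConvex (𝕜 : Type*) (X : Type*) [RCLike 𝕜] [AddCommGroup X] [Module 𝕜 X]
    [TopologicalSpace X] : Prop :=
  letI := realModule 𝕜 X
  LocallyConvexSpace ℝ X

/-- A (real) quasi-Banach lattice: a quasi-Banach space that is a vector lattice with a quasi-norm
that is monotone with respect to the modulus. -/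
class IsQuasiBanachLattice (L : Type*) [AddCommGroup L] [Module ℝ L] [TopologicalSpace L]
    [IsTopologicalAddGroup L] [ContinuousSMul ℝ L] [QuasiBanachSpace ℝ L] [Lattice L] : Prop
    extends IsOrderedAddMonoid L, IsOrderedModule ℝ L where
  solid : ∀ x y : L, |x| ≤ |y| → QuasiBanachSpace.qnorm ℝ x ≤ QuasiBanachSpace.qnorm ℝ y

/-- Kalton's `L`-convexity: if `0 ≤ f i ≤ g` and the average of the `f i` is at least `(1 - ε) g`,
then some `f i` has quasi-norm at least `ε ‖g‖`. -/
def IsLConvex (L : Type*) [AddCommGroup L] [Module ℝ L] [TopologicalSpace L]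
    [IsTopologicalAddGroup L] [ContinuousSMul ℝ L] [QuasiBanachSpace ℝ L] [Lattice L] : Prop :=
  ∃ ε : ℝ, 0 < ε ∧ ∀ (k : ℕ), 0 < k → ∀ (g : L) (f : Fin k → L),
    (∀ i, 0 ≤ f i ∧ f i ≤ g) → ((1 - ε) * (k : ℝ)) • g ≤ ∑ i, f i →
      ∃ i, ε * QuasiBanachSpace.qnorm ℝ g ≤ QuasiBanachSpace.qnorm ℝ (f i)

/-- `X` is natural: it is isomorphic to a subspace of an `L`-convex quasi-Banach lattice.
For `𝕜 = ℂ` the embedding is real-linear into the real lattice `L`; this is the same as a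
complex-linear embedding into the complexification of such a lattice, since a real-linear embedding
`T` gives the complex-linear embedding `x ↦ T x - i T (i x)` into `L ⊕ i L`, and the real space
underlying `L ⊕ i L` is the lattice `L × L`. -/
def IsNatural (𝕜 : Type*) (X : Type u) [RCLike 𝕜] [AddCommGroup X] [Module 𝕜 X]
    [TopologicalSpace X] : Prop :=
  letI := realModule 𝕜 X
  ∃ (L : Type u) (_ : AddCommGroup L) (_ : Module ℝ L) (_ : TopologicalSpace L)
    (_ : IsTopologicalAddGroup L) (_ : ContinuousSMul ℝ L) (_ : QuasiBanachSpace ℝ L)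
    (_ : Lattice L) (_ : IsQuasiBanachLattice L),
    IsLConvex L ∧ ∃ T : X →ₗ[ℝ] L, IsEmbedding T

/-- The Banach space `U` is a proper envelope: it is isomorphic to the Banach envelope of a
non-locally convex quasi-Banach space `Y`. As always when Banach envelopes are compared with the
original space, the dual of `Y` is required to separate points (equivalently, the envelope map is
injective): otherwise `Y = U ⊕ L_p[0,1]` with `p < 1`, whose envelope is `U`, would make every `U` a
proper envelope. In particular `Y` injects into `U`, so the size of the universe of `Y` is
immaterial as soon as it contains `U`. -/
def IsProperEnvelope (𝕜 : Type*) (U : Type v) [RCLike 𝕜] [NormedAddCommGroup U]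
    [NormedSpace 𝕜 U] : Prop :=
  ∃ (Y : Type w) (_ : AddCommGroup Y) (_ : Module 𝕜 Y) (_ : TopologicalSpace Y)
    (_ : IsTopologicalAddGroup Y) (_ : ContinuousSMul 𝕜 Y) (_ : QuasiBanachSpace 𝕜 Y),
    SeparatingDual 𝕜 Y ∧ ¬ IsLocallyConvex 𝕜 Y ∧ Nonempty (BanachEnvelope 𝕜 Y ≃L[𝕜] U)

/-- The Banach space `U` is a proper envelope of a natural space; same convention as for
`IsProperEnvelope`. -/
def IsProperEnvelopeOfNatural (𝕜 : Type*) (U : Type v) [RCLike 𝕜] [NormedAddCommGroup U]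
    [NormedSpace 𝕜 U] : Prop :=
  ∃ (Y : Type w) (_ : AddCommGroup Y) (_ : Module 𝕜 Y) (_ : TopologicalSpace Y)
    (_ : IsTopologicalAddGroup Y) (_ : ContinuousSMul 𝕜 Y) (_ : QuasiBanachSpace 𝕜 Y),
    SeparatingDual 𝕜 Y ∧ IsNatural 𝕜 Y ∧ ¬ IsLocallyConvex 𝕜 Y ∧
      Nonempty (BanachEnvelope 𝕜 Y ≃L[𝕜] U)

/-! ### Quasi-Banach spaces -/

namespace QuasiBanachSpace

variable {𝕜 : Type*} [RCLike 𝕜]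
  {E : Type*} [AddCommGroup E] [Module 𝕜 E] [TopologicalSpace E] [IsTopologicalAddGroup E]
  [ContinuousSMul 𝕜 E] [QuasiBanachSpace 𝕜 E]
  {F : Type*} [AddCommGroup F] [Module 𝕜 F] [TopologicalSpace F] [IsTopologicalAddGroup F]
  [ContinuousSMul 𝕜 F] [QuasiBanachSpace 𝕜 F]

/-! An unconditional basis of `X ⊕ U` has uniformly bounded partial sum projections. These extend to
the envelope `X̂ ⊕ U`, where the image of the basis is again an unconditional basis
(`IsUnconditionalBasis.envelopeProd`). Splitting there yields an index set `A` whose spans in the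
envelope are copies of `X̂` and `U`; it remains to compare the spans of the original vectors with
`X` and `U`.

Let `P` be the coordinate projection onto `[b n : n ∈ A]`. Splitting for complemented subspaces
moves its range onto the range of a diagonal projection `Q₁ ⊕ Q₂`. Equality of ranges up to an
automorphism is rephrased as `d * c = P`, `c * d = Q₁ ⊕ Q₂`, with a similar pair for the
complementary idempotents. Such identities survive extension to the envelope, where `Q₁` becomes
some `R₁`. Hence `X̂ ≃ ran R₁ ⊕ ran Q₂` and `U ≃ ran (1 - R₁) ⊕ ran (1 - Q₂)`.

So `ran Q₂` is complemented in both `U` and `X̂`, and so is `ran (1 - R₁)`: incomparability makes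
both finite-dimensional. The coordinate functionals separate points, so the envelope map is
injective and `ran (1 - Q₁)` is finite-dimensional as well. Therefore `[b n : n ∈ A]` and its
complementary span differ from `X` and `U` by finite-dimensional summands only. Moving finitely many
indices across corrects the dimensions, because one-dimensional summands cancel
(`nonempty_equiv_of_prod_equiv`, `IsUnconditionalBasis.exists_transfer`). -/

theorem qnorm_zero : qnorm 𝕜 (0 : E) = 0 := (qnorm_eq_zero _).2 rfl

theorem qnorm_neg (x : E) : qnorm 𝕜 (-x) = qnorm 𝕜 x := by
  simpa using qnorm_smul (-1 : 𝕜) x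

theorem qnorm_sub_comm (x y : E) : qnorm 𝕜 (x - y) = qnorm 𝕜 (y - x) := by
  rw [← qnorm_neg, neg_sub]

theorem tendsto_iff_qnorm {α : Type*} {l : Filter α} {s : α → E} {x : E} :
    Tendsto s l (𝓝 x) ↔ ∀ ε : ℝ, 0 < ε → ∀ᶠ i in l, qnorm 𝕜 (s i - x) < ε := by
  rw [← tendsto_sub_nhds_zero_iff, (nhds_zero_basis (𝕜 := 𝕜) (X := E)).tendsto_right_iff]
  rfl

theorem t2Space (𝕜 E : Type*) [RCLike 𝕜] [AddCommGroup E] [Module 𝕜 E]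
    [TopologicalSpace E] [IsTopologicalAddGroup E] [ContinuousSMul 𝕜 E] [QuasiBanachSpace 𝕜 E] : T2Space E := by
  refine IsTopologicalAddGroup.t2Space_of_zero_sep fun x hx => ?_
  have h0 : 0 < qnorm 𝕜 x :=
    lt_of_le_of_ne (qnorm_nonneg x) fun h => hx ((qnorm_eq_zero x).1 h.symm)
  exact ⟨{y | qnorm 𝕜 y < qnorm 𝕜 x},
    (nhds_zero_basis (𝕜 := 𝕜) (X := E)).mem_of_mem h0, fun h => lt_irrefl (qnorm 𝕜 x) h⟩

theorem isCountablyGenerated_nhds_zero (𝕜 E : Type*) [RCLike 𝕜] [AddCommGroup E] [Module 𝕜 E]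
    [TopologicalSpace E] [IsTopologicalAddGroup E] [ContinuousSMul 𝕜 E] [QuasiBanachSpace 𝕜 E] :
    (𝓝 (0 : E)).IsCountablyGenerated := by
  refine HasCountableBasis.isCountablyGenerated
    (p := fun _ : ℕ => True) (s := fun n : ℕ => {x : E | qnorm 𝕜 x < 1 / ((n : ℝ) + 1)})
    ⟨(nhds_zero_basis (𝕜 := 𝕜) (X := E)).to_hasBasis (fun ε hε => ?_) (fun n _ => ?_),
      Set.to_countable _⟩
  · obtain ⟨n, hn⟩ := exists_nat_one_div_lt hε
    exact ⟨n, trivial, fun x hx => lt_trans hx hn⟩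
  · exact ⟨1 / ((n : ℝ) + 1), by positivity, subset_rfl⟩

/-- The uniformity is countably generated, so completeness for sequences suffices. -/
theorem completeSpace (𝕜 E : Type*) [RCLike 𝕜] [AddCommGroup E] [Module 𝕜 E]
    [TopologicalSpace E] [IsTopologicalAddGroup E] [ContinuousSMul 𝕜 E] [QuasiBanachSpace 𝕜 E] :
    letI := IsTopologicalAddGroup.rightUniformSpace E
    CompleteSpace E := by
  let _ := IsTopologicalAddGroup.rightUniformSpace E
  have : IsUniformAddGroup E := isUniformAddGroup_of_addCommGroup
  have := isCountablyGenerated_nhds_zero 𝕜 E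
  have : (uniformity E).IsCountablyGenerated := IsUniformAddGroup.uniformity_countably_generated
  refine UniformSpace.complete_of_cauchySeq_tendsto fun s hs => complete (𝕜 := 𝕜) s fun ε hε => ?_
  have hmem : {p : E × E | qnorm 𝕜 (p.2 - p.1) < ε} ∈ uniformity E := by
    rw [uniformity_eq_comap_nhds_zero]
    exact preimage_mem_comap ((nhds_zero_basis (𝕜 := 𝕜) (X := E)).mem_of_mem hε)
  rw [cauchySeq_iff] at hs
  obtain ⟨N, hN⟩ := hs _ hmem
  exact ⟨N, fun m hm n hn => hN n hn m hm⟩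

theorem baireSpace (𝕜 E : Type*) [RCLike 𝕜] [AddCommGroup E] [Module 𝕜 E]
    [TopologicalSpace E] [IsTopologicalAddGroup E] [ContinuousSMul 𝕜 E] [QuasiBanachSpace 𝕜 E] : BaireSpace E := by
  let _ := IsTopologicalAddGroup.rightUniformSpace E
  have : IsUniformAddGroup E := isUniformAddGroup_of_addCommGroup
  have := isCountablyGenerated_nhds_zero 𝕜 E
  have : (uniformity E).IsCountablyGenerated := IsUniformAddGroup.uniformity_countably_generated
  have := completeSpace 𝕜 E
  infer_instance

/-! ### Bounded operators and series in quasi-norms -/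

theorem continuous_of_bound (T : E →ₗ[𝕜] F) (C : ℝ)
    (h : ∀ x, qnorm 𝕜 (T x) ≤ C * qnorm 𝕜 x) : Continuous T := by
  refine continuous_of_continuousAt_zero T ?_
  rw [ContinuousAt, map_zero, tendsto_iff_qnorm (𝕜 := 𝕜)]
  intro ε hε
  have hpos : 0 < ε / (|C| + 1) := by positivity
  filter_upwards [(nhds_zero_basis (𝕜 := 𝕜) (X := E)).mem_of_mem hpos] with x hx
  rw [sub_zero]
  have hx' : qnorm 𝕜 x * (|C| + 1) < ε := (lt_div_iff₀ (by positivity)).1 hx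
  have := qnorm_nonneg (𝕜 := 𝕜) x
  nlinarith [h x, le_abs_self C]

theorem exists_bound (T : E →L[𝕜] F) :
    ∃ C : ℝ, 0 < C ∧ ∀ x, qnorm 𝕜 (T x) ≤ C * qnorm 𝕜 x := by
  have h := (tendsto_iff_qnorm (𝕜 := 𝕜)).1 (T.continuous.tendsto 0) 1 one_pos
  obtain ⟨δ, hδ, hsub⟩ := (nhds_zero_basis (𝕜 := 𝕜) (X := E)).mem_iff.1 h
  refine ⟨2 / δ, by positivity, fun x => ?_⟩
  by_cases hx : x = 0
  · simp [hx, qnorm_zero]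
  have h0 : 0 < qnorm 𝕜 x :=
    lt_of_le_of_ne (qnorm_nonneg x) fun h => hx ((qnorm_eq_zero x).1 h.symm)
  have ht : 0 < δ / (2 * qnorm 𝕜 x) := by positivity
  have hmem : qnorm 𝕜 (((δ / (2 * qnorm 𝕜 x) : ℝ) : 𝕜) • x) < δ := by
    rw [qnorm_smul, RCLike.norm_ofReal, abs_of_pos ht]
    field_simp
    norm_num
  have := hsub hmem
  simp only [Set.mem_ofPred_eq, map_zero, sub_zero, map_smul, qnorm_smul, RCLike.norm_ofReal,
    abs_of_pos ht] at this
  rw [div_mul_eq_mul_div, div_lt_one (by positivity)] at this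
  rw [div_mul_eq_mul_div, le_div_iff₀ hδ]
  linarith

/-- Splitting off the first term at each stage costs the `k`-th term a factor `κ ^ (k + 1)`. This is
why series are later compared with the ratio `(2 * κ)⁻¹`: a factor `2⁻¹` per term is left over. -/
theorem qnorm_sum_range_le {κ : ℝ} (hκ : 1 ≤ κ)
    (hq : ∀ x y : E, qnorm 𝕜 (x + y) ≤ κ * (qnorm 𝕜 x + qnorm 𝕜 y)) (n : ℕ) (x : ℕ → E) :
    qnorm 𝕜 (∑ k ∈ Finset.range n, x k) ≤ ∑ k ∈ Finset.range n, κ ^ (k + 1) * qnorm 𝕜 (x k) := by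
  induction n generalizing x with
  | zero => simp [qnorm_zero]
  | succ n ih =>
    rw [Finset.sum_range_succ', Finset.sum_range_succ']
    refine (hq _ _).trans ?_
    rw [mul_add]
    refine add_le_add ?_ (by simp)
    refine (mul_le_mul_of_nonneg_left (ih fun k => x (k + 1)) (by linarith)).trans_eq ?_
    rw [Finset.mul_sum]
    exact Finset.sum_congr rfl fun k _ => by ring

theorem qnorm_sum_geometric_le {κ : ℝ} (hκ : 1 ≤ κ)
    (hq : ∀ x y : E, qnorm 𝕜 (x + y) ≤ κ * (qnorm 𝕜 x + qnorm 𝕜 y)) {M : ℝ} (hM : 0 ≤ M)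
    {x : ℕ → E} (hx : ∀ k, qnorm 𝕜 (x k) ≤ M * (2 * κ)⁻¹ ^ k) (n : ℕ) :
    qnorm 𝕜 (∑ k ∈ Finset.range n, x k) ≤ 2 * κ * M := by
  have hκ0 : 0 < κ := by linarith
  calc qnorm 𝕜 (∑ k ∈ Finset.range n, x k)
      ≤ ∑ k ∈ Finset.range n, κ ^ (k + 1) * qnorm 𝕜 (x k) := qnorm_sum_range_le hκ hq n x
    _ ≤ ∑ k ∈ Finset.range n, κ * M * (1 / 2) ^ k := by
        refine Finset.sum_le_sum fun k _ => ?_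
        refine (mul_le_mul_of_nonneg_left (hx k) (by positivity)).trans_eq ?_
        have : κ ^ k * (2 * κ)⁻¹ ^ k = (1 / 2) ^ k := by
          rw [← mul_pow]
          congr 1
          field_simp
        rw [← this]
        ring
    _ = κ * M * ∑ k ∈ Finset.range n, (1 / 2 : ℝ) ^ k := by rw [Finset.mul_sum]
    _ ≤ κ * M * 2 := mul_le_mul_of_nonneg_left (sum_geometric_two_le n) (by positivity)
    _ = 2 * κ * M := by ring

/-- A quasi-norm need not be continuous, so passing to the limit costs a factor `κ`. -/
theorem qnorm_le_of_tendsto {κ : ℝ} (hκ : 1 ≤ κ)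
    (hq : ∀ x y : E, qnorm 𝕜 (x + y) ≤ κ * (qnorm 𝕜 x + qnorm 𝕜 y)) {α : Type*} {l : Filter α}
    [l.NeBot] {s : α → E} {x : E} (hs : Tendsto s l (𝓝 x)) {C : ℝ}
    (hC : ∀ᶠ i in l, qnorm 𝕜 (s i) ≤ C) : qnorm 𝕜 x ≤ κ * C := by
  refine le_of_forall_pos_le_add fun ε hε => ?_
  have hκ0 : 0 < κ := by linarith
  obtain ⟨i, hi, hi'⟩ :=
    (((tendsto_iff_qnorm (𝕜 := 𝕜)).1 hs (ε / κ) (by positivity)).and hC).exists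
  have h := hq (s i) (x - s i)
  rw [add_sub_cancel, qnorm_sub_comm] at h
  calc qnorm 𝕜 x ≤ κ * (C + ε / κ) := h.trans (by gcongr)
    _ = κ * C + ε := by field_simp

/-- A geometrically dominated series converges, with control of the remainders. -/
theorem exists_tendsto_of_geometric {κ : ℝ} (hκ : 1 ≤ κ)
    (hq : ∀ x y : E, qnorm 𝕜 (x + y) ≤ κ * (qnorm 𝕜 x + qnorm 𝕜 y)) {M : ℝ} (hM : 0 ≤ M)
    {x : ℕ → E} (hx : ∀ k, qnorm 𝕜 (x k) ≤ M * (2 * κ)⁻¹ ^ k) :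
    ∃ y, Tendsto (fun n => ∑ k ∈ Finset.range n, x k) atTop (𝓝 y) ∧
      ∀ m, qnorm 𝕜 (y - ∑ k ∈ Finset.range m, x k) ≤ 2 * κ ^ 2 * M * (2 * κ)⁻¹ ^ m := by
  have hκ0 : 0 < κ := by linarith
  have htail : ∀ m n, qnorm 𝕜 (∑ k ∈ Finset.range (m + n), x k - ∑ k ∈ Finset.range m, x k)
      ≤ 2 * κ * (M * (2 * κ)⁻¹ ^ m) := by
    intro m n
    rw [Finset.sum_range_add, add_sub_cancel_left]
    refine qnorm_sum_geometric_le hκ hq (by positivity) (fun k => ?_) n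
    rw [mul_assoc, ← pow_add]
    exact hx _
  have hgeom : Tendsto (fun m => 2 * κ * (M * (2 * κ)⁻¹ ^ m)) atTop (𝓝 0) := by
    have h1 : (2 * κ)⁻¹ < 1 := inv_lt_one_of_one_lt₀ (by linarith)
    simpa using ((tendsto_pow_atTop_nhds_zero_of_lt_one (by positivity) h1).const_mul M).const_mul
      (2 * κ)
  obtain ⟨y, hy⟩ := complete (𝕜 := 𝕜) (fun n => ∑ k ∈ Finset.range n, x k) fun ε hε => by
    obtain ⟨N, hN⟩ := (hgeom.eventually_lt_const hε).exists
    have key : ∀ m n, N ≤ m → m ≤ n →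
        qnorm 𝕜 (∑ k ∈ Finset.range n, x k - ∑ k ∈ Finset.range m, x k) < ε := by
      intro m n hm hn
      obtain ⟨d, rfl⟩ := Nat.exists_eq_add_of_le hn
      refine (htail m d).trans_lt (lt_of_le_of_lt ?_ hN)
      have : (2 * κ)⁻¹ ^ m ≤ (2 * κ)⁻¹ ^ N :=
        pow_le_pow_of_le_one (by positivity) (inv_le_one_of_one_le₀ (by linarith)) hm
      gcongr
    refine ⟨N, fun m hm n hn => ?_⟩
    rcases le_total m n with h | h
    · rw [qnorm_sub_comm]
      exact key m n hm h
    · exact key n m hn h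
  refine ⟨y, hy, fun m => ?_⟩
  refine (qnorm_le_of_tendsto (C := 2 * κ * (M * (2 * κ)⁻¹ ^ m)) hκ hq
    (hy.sub_const _) ?_).trans_eq (by ring)
  filter_upwards [eventually_ge_atTop m] with n hn
  obtain ⟨d, rfl⟩ := Nat.exists_eq_add_of_le hn
  exact htail m d

/-- Banach spaces are quasi-Banach spaces. -/
instance ofBanach {U : Type*} [NormedAddCommGroup U] [NormedSpace 𝕜 U] [CompleteSpace U] :
    QuasiBanachSpace 𝕜 U where
  qnorm := norm
  qnorm_nonneg := norm_nonneg
  qnorm_eq_zero _ := norm_eq_zero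
  qnorm_smul := norm_smul
  exists_modulus := ⟨1, le_rfl, fun x y => by simpa using norm_add_le x y⟩
  nhds_zero_basis := by
    refine (Metric.nhds_basis_ball (x := (0 : U))).to_hasBasis
      (fun ε hε => ⟨ε, hε, fun x hx => mem_ball_zero_iff.2 hx⟩)
      (fun ε hε => ⟨ε, hε, fun x hx => mem_ball_zero_iff.1 hx⟩)
  complete s hs := by
    refine cauchySeq_tendsto_of_complete (Metric.cauchySeq_iff.2 fun ε hε => ?_)
    obtain ⟨N, hN⟩ := hs ε hε
    exact ⟨N, fun m hm n hn => by simpa [dist_eq_norm] using hN m hm n hn⟩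

/-- The product of two quasi-Banach spaces, with the maximum quasi-norm. -/
instance prod : QuasiBanachSpace 𝕜 (E × F) where
  qnorm z := max (qnorm 𝕜 z.1) (qnorm 𝕜 z.2)
  qnorm_nonneg z := le_max_of_le_left (qnorm_nonneg _)
  qnorm_eq_zero z := by
    constructor
    · intro h
      have h1 : qnorm 𝕜 z.1 = 0 :=
        le_antisymm (h ▸ le_max_left _ _) (qnorm_nonneg _)
      have h2 : qnorm 𝕜 z.2 = 0 :=
        le_antisymm (h ▸ le_max_right _ _) (qnorm_nonneg _)
      exact Prod.ext ((qnorm_eq_zero _).1 h1) ((qnorm_eq_zero _).1 h2)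
    · rintro rfl
      simp [qnorm_zero]
  qnorm_smul a z := by
    simp only [Prod.smul_fst, Prod.smul_snd, qnorm_smul]
    exact (mul_max_of_nonneg _ _ (norm_nonneg a)).symm
  exists_modulus := by
    obtain ⟨κ₁, h₁, hq₁⟩ := exists_modulus (𝕜 := 𝕜) (X := E)
    obtain ⟨κ₂, h₂, hq₂⟩ := exists_modulus (𝕜 := 𝕜) (X := F)
    refine ⟨max κ₁ κ₂, le_max_of_le_left h₁, fun x y => max_le ?_ ?_⟩
    · refine (hq₁ _ _).trans (mul_le_mul (le_max_left _ _)
        (add_le_add (le_max_left _ _) (le_max_left _ _))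
        (add_nonneg (qnorm_nonneg _) (qnorm_nonneg _)) (le_max_of_le_left (by linarith)))
    · refine (hq₂ _ _).trans (mul_le_mul (le_max_right _ _)
        (add_le_add (le_max_right _ _) (le_max_right _ _))
        (add_nonneg (qnorm_nonneg _) (qnorm_nonneg _)) (le_max_of_le_left (by linarith)))
  nhds_zero_basis := by
    rw [← Prod.mk_zero_zero, nhds_prod_eq]
    refine ((nhds_zero_basis (𝕜 := 𝕜) (X := E)).prod
      (nhds_zero_basis (𝕜 := 𝕜) (X := F))).to_hasBasis ?_ ?_
    · rintro ⟨ε, δ⟩ ⟨hε, hδ⟩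
      exact ⟨min ε δ, lt_min hε hδ, fun z hz =>
        ⟨(le_max_left _ _).trans_lt (lt_of_lt_of_le (Set.mem_ofPred.1 hz) (min_le_left _ _)),
          (le_max_right _ _).trans_lt (lt_of_lt_of_le (Set.mem_ofPred.1 hz) (min_le_right _ _))⟩⟩
    · intro ε hε
      exact ⟨(ε, ε), ⟨hε, hε⟩, fun z hz => Set.mem_ofPred.2 (max_lt hz.1 hz.2)⟩
  complete s hs := by
    obtain ⟨x, hx⟩ := complete (𝕜 := 𝕜) (fun n => (s n).1) fun ε hε => by
      obtain ⟨N, hN⟩ := hs ε hε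
      exact ⟨N, fun m hm n hn => lt_of_le_of_lt (le_max_left _ _) (hN m hm n hn)⟩
    obtain ⟨y, hy⟩ := complete (𝕜 := 𝕜) (fun n => (s n).2) fun ε hε => by
      obtain ⟨N, hN⟩ := hs ε hε
      exact ⟨N, fun m hm n hn => lt_of_le_of_lt (le_max_right _ _) (hN m hm n hn)⟩
    exact ⟨(x, y), hx.prodMk_nhds hy⟩

end QuasiBanachSpace

/-! ### Unconditional bases: coordinates and partial sums -/

namespace IsUnconditionalBasis

open QuasiBanachSpace

variable {𝕜 : Type*} [RCLike 𝕜]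
  {E : Type*} [AddCommGroup E] [Module 𝕜 E] [TopologicalSpace E] [IsTopologicalAddGroup E]
  [ContinuousSMul 𝕜 E] {ι : Type*} {b : ι → E}

/-- The coefficients of a vector with respect to an unconditional basis. -/
noncomputable def coeff (hb : IsUnconditionalBasis 𝕜 b) (f : E) : ι → 𝕜 :=
  (hb.existsUnique_hasSum f).choose

theorem hasSum_coeff (hb : IsUnconditionalBasis 𝕜 b) (f : E) :
    HasSum (fun n => hb.coeff f n • b n) f :=
  (hb.existsUnique_hasSum f).choose_spec.1

theorem coeff_eq (hb : IsUnconditionalBasis 𝕜 b) {f : E} {a : ι → 𝕜}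
    (h : HasSum (fun n => a n • b n) f) : hb.coeff f = a :=
  ((hb.existsUnique_hasSum f).choose_spec.2 a h).symm

/-- The coordinate functionals as linear maps. -/
noncomputable def coord (hb : IsUnconditionalBasis 𝕜 b) (n : ι) : E →ₗ[𝕜] 𝕜 where
  toFun f := hb.coeff f n
  map_add' f g := by
    have h := (hb.hasSum_coeff f).add (hb.hasSum_coeff g)
    simp only [← add_smul] at h
    exact congrFun (hb.coeff_eq h) n
  map_smul' c f := by
    have h := (hb.hasSum_coeff f).const_smul c
    simp only [← mul_smul] at h
    exact congrFun (hb.coeff_eq h) n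

theorem hasSum_coord (hb : IsUnconditionalBasis 𝕜 b) (f : E) :
    HasSum (fun n => hb.coord n f • b n) f := hb.hasSum_coeff f

theorem coord_eq (hb : IsUnconditionalBasis 𝕜 b) {f : E} {a : ι → 𝕜}
    (h : HasSum (fun n => a n • b n) f) (n : ι) : hb.coord n f = a n :=
  congrFun (hb.coeff_eq h) n

open Classical in
theorem coord_apply (hb : IsUnconditionalBasis 𝕜 b) (m n : ι) :
    hb.coord m (b n) = if m = n then 1 else 0 := by
  refine hb.coord_eq (a := fun m => if m = n then 1 else 0) ?_ m
  have h := hasSum_single (f := fun m => (if m = n then (1 : 𝕜) else 0) • b m) n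
    fun m hm => by simp [hm]
  simpa using h

theorem ne_zero (hb : IsUnconditionalBasis 𝕜 b) (n : ι) : b n ≠ 0 := by
  classical
  intro h
  have := hb.coord_apply n n
  simp [h] at this

/-- The partial sum projections. -/
noncomputable def partialSum (hb : IsUnconditionalBasis 𝕜 b) (s : Finset ι) : E →ₗ[𝕜] E :=
  ∑ n ∈ s, (hb.coord n).smulRight (b n)

theorem partialSum_apply (hb : IsUnconditionalBasis 𝕜 b) (s : Finset ι) (f : E) :
    hb.partialSum s f = ∑ n ∈ s, hb.coord n f • b n := by
  simp [partialSum]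

/-! ### Uniform boundedness of the partial sum projections -/

variable [QuasiBanachSpace 𝕜 E]

/-- Beyond some finite `t` the partial sums are within `1` of `f`. A general `s` differs from `s ∪
t` by a subset of `t`, and there are only finitely many of those. -/
theorem exists_partialSum_le (hb : IsUnconditionalBasis 𝕜 b) (f : E) :
    ∃ r : ℕ, ∀ s, qnorm 𝕜 (hb.partialSum s f) ≤ r := by
  classical
  obtain ⟨κ, hκ, hq⟩ := exists_modulus (𝕜 := 𝕜) (X := E)
  obtain ⟨t, ht⟩ := eventually_atTop.1
    ((tendsto_iff_qnorm (𝕜 := 𝕜)).1 (hb.hasSum_coord f) 1 one_pos)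
  set R := ∑ s ∈ t.powerset, qnorm 𝕜 (hb.partialSum s f) with hR
  obtain ⟨r, hr⟩ := exists_nat_ge (κ * (κ * (1 + qnorm 𝕜 f) + R))
  refine ⟨r, fun s => le_trans ?_ hr⟩
  have hsplit : hb.partialSum s f = hb.partialSum (s ∪ t) f + -hb.partialSum (t \ s) f := by
    rw [← sub_eq_add_neg, eq_sub_iff_add_eq, partialSum_apply, partialSum_apply, partialSum_apply,
      ← Finset.sum_union Finset.disjoint_sdiff, Finset.union_sdiff_self_eq_union]
  have h1 : qnorm 𝕜 (hb.partialSum (s ∪ t) f) ≤ κ * (1 + qnorm 𝕜 f) := by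
    have h := hq (hb.partialSum (s ∪ t) f - f) f
    rw [sub_add_cancel] at h
    refine h.trans ?_
    have := ht (s ∪ t) Finset.subset_union_right
    rw [← partialSum_apply] at this
    gcongr
  have h2 : qnorm 𝕜 (hb.partialSum (t \ s) f) ≤ R :=
    Finset.single_le_sum (f := fun s => qnorm 𝕜 (hb.partialSum s f))
      (fun _ _ => qnorm_nonneg _) (Finset.mem_powerset.2 Finset.sdiff_subset)
  rw [hsplit]
  refine (hq _ _).trans ?_
  rw [qnorm_neg]
  gcongr

/-- The Baire category half of an open mapping argument. Continuity of the coordinates is not yet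
known, so the sets `S r` need not be closed; Baire applies to their closures and bounds only a dense
part of a ball. -/
theorem exists_approx_partialSum_le (hb : IsUnconditionalBasis 𝕜 b) :
    ∃ c : ℝ, 0 < c ∧ ∀ (f : E) (ε : ℝ), 0 < ε → ∃ g,
      (∀ s, qnorm 𝕜 (hb.partialSum s g) ≤ c * qnorm 𝕜 f) ∧ qnorm 𝕜 (f - g) ≤ ε * qnorm 𝕜 f := by
  obtain ⟨κ, hκ, hq⟩ := exists_modulus (𝕜 := 𝕜) (X := E)
  have := baireSpace 𝕜 E
  let S : ℕ → Set E := fun r => {f | ∀ s, qnorm 𝕜 (hb.partialSum s f) ≤ r}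
  have hS : ⋃ r, closure (S r) = Set.univ := by
    refine Set.eq_univ_of_forall fun f => ?_
    obtain ⟨r, hr⟩ := hb.exists_partialSum_le f
    exact Set.mem_iUnion.2 ⟨r, subset_closure hr⟩
  obtain ⟨r, x, hx⟩ := nonempty_interior_of_iUnion_of_closed (fun _ => isClosed_closure) hS
  have hnhds : ∀ᶠ z in 𝓝 (0 : E), x + z ∈ closure (S r) := by
    have h : Tendsto (fun z => x + z) (𝓝 0) (𝓝 x) := by
      simpa using (continuous_const_add x).tendsto 0
    exact h.eventually (mem_interior_iff_mem_nhds.1 hx)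
  obtain ⟨δ, hδ, hsub⟩ := (nhds_zero_basis (𝕜 := 𝕜) (X := E)).mem_iff.1 hnhds
  set R : ℝ := κ * (r + r) with hR
  have hball : ∀ z, qnorm 𝕜 z < δ →
      z ∈ closure {f | ∀ s, qnorm 𝕜 (hb.partialSum s f) ≤ R} := by
    intro z hz
    have h := map_mem_closure₂ (u := {f | ∀ s, qnorm 𝕜 (hb.partialSum s f) ≤ R})
      continuous_sub (hsub hz : x + z ∈ closure (S r)) (interior_subset hx) ?_
    · simpa using h
    · intro f hf g hg s
      rw [map_sub, sub_eq_add_neg]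
      refine (hq _ _).trans ?_
      rw [qnorm_neg, hR]
      have := hf s
      have := hg s
      gcongr
  -- A nonzero `f` is rescaled to quasi-norm `δ / 2`. Using `R + 1` keeps the constant positive even
  -- when `r = 0`.
  refine ⟨2 * (R + 1) / δ, by positivity, fun f ε hε => ?_⟩
  by_cases hf : f = 0
  · exact ⟨0, fun s => by simp [hf, qnorm_zero], by simp [hf, qnorm_zero]⟩
  have h0 : 0 < qnorm 𝕜 f :=
    lt_of_le_of_ne (qnorm_nonneg f) fun h => hf ((qnorm_eq_zero f).1 h.symm)
  set t : ℝ := δ / (2 * qnorm 𝕜 f) with ht_def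
  have ht : 0 < t := by positivity
  have ht' : (t : 𝕜) ≠ 0 := by exact_mod_cast ht.ne'
  have hmem : qnorm 𝕜 ((t : 𝕜) • f) < δ := by
    rw [qnorm_smul, RCLike.norm_ofReal, abs_of_pos ht, ht_def]
    field_simp
    norm_num
  have hnear : {g | qnorm 𝕜 (g - (t : 𝕜) • f) < t * (ε * qnorm 𝕜 f)} ∈ 𝓝 ((t : 𝕜) • f) :=
    (tendsto_iff_qnorm (𝕜 := 𝕜)).1 tendsto_id _ (by positivity)
  obtain ⟨g, hg1, hg2⟩ := mem_closure_iff_nhds.1 (hball _ hmem) _ hnear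
  refine ⟨(t : 𝕜)⁻¹ • g, fun s => ?_, ?_⟩
  · rw [map_smul, qnorm_smul, norm_inv, RCLike.norm_ofReal, abs_of_pos ht]
    calc t⁻¹ * qnorm 𝕜 (hb.partialSum s g) ≤ t⁻¹ * (R + 1) := by
          have := hg2 s
          gcongr
          linarith
      _ = 2 * (R + 1) / δ * qnorm 𝕜 f := by
          rw [ht_def]
          field_simp
  · have h : f - (t : 𝕜)⁻¹ • g = (t : 𝕜)⁻¹ • ((t : 𝕜) • f - g) := by
      rw [smul_sub, smul_smul, inv_mul_cancel₀ ht', one_smul]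
    rw [h, qnorm_smul, norm_inv, RCLike.norm_ofReal, abs_of_pos ht, qnorm_sub_comm]
    rw [inv_mul_le_iff₀ ht]
    exact (Set.mem_ofPred.1 hg1).le

/-- The partial sum projections of an unconditional basis are uniformly bounded. -/
theorem exists_partialSum_bound (hb : IsUnconditionalBasis 𝕜 b) :
    ∃ C : ℝ, 0 < C ∧ ∀ s f, qnorm 𝕜 (hb.partialSum s f) ≤ C * qnorm 𝕜 f := by
  classical
  obtain ⟨κ, hκ, hq⟩ := exists_modulus (𝕜 := 𝕜) (X := E)
  have hκ0 : 0 < κ := by linarith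
  have := t2Space 𝕜 E
  obtain ⟨c, hc, happrox⟩ := hb.exists_approx_partialSum_le
  choose g hg hg' using fun f => happrox f (2 * κ)⁻¹ (by positivity)
  refine ⟨2 * κ ^ 2 * c, by positivity, fun s f => ?_⟩
  set M := qnorm 𝕜 f with hM
  have hM0 : 0 ≤ M := qnorm_nonneg f
  -- `r k` is the error after `k` steps of the approximation and `g (r k)` is the next term
  let r : ℕ → E := fun k => (fun h => h - g h)^[k] f
  have hr_succ : ∀ k, r (k + 1) = r k - g (r k) := fun k =>
    Function.iterate_succ_apply' _ _ _
  have hr : ∀ k, qnorm 𝕜 (r k) ≤ M * (2 * κ)⁻¹ ^ k := by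
    intro k
    induction k with
    | zero => simp [r, hM]
    | succ k ih =>
      rw [hr_succ]
      refine (hg' _).trans ((mul_le_mul_of_nonneg_left ih (by positivity)).trans_eq ?_)
      ring
  have hsum : ∀ n, ∑ k ∈ Finset.range n, g (r k) = f - r n := by
    intro n
    induction n with
    | zero => simp [r]
    | succ n ih => rw [Finset.sum_range_succ, ih, hr_succ]; abel
  have hterm : ∀ (s : Finset ι) k,
      qnorm 𝕜 (hb.partialSum s (g (r k))) ≤ (c * M) * (2 * κ)⁻¹ ^ k := by
    intro s k
    refine (hg _ s).trans ((mul_le_mul_of_nonneg_left (hr k) hc.le).trans_eq ?_)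
    ring
  choose y hy hy' using fun s => exists_tendsto_of_geometric hκ hq (by positivity) (hterm s)
  -- Lines are closed, so the limit `y {n}` is a multiple of `b n` although the coordinates are not
  -- known to be continuous. The scalars `a n` are the candidates for the coefficients of `f`.
  have hline : ∀ n, ∃ a : 𝕜, a • b n = y {n} := by
    intro n
    rw [← Submodule.mem_span_singleton]
    have hclosed : IsClosed (Submodule.span 𝕜 {b n} : Set E) :=
      Submodule.closed_of_finiteDimensional _
    refine hclosed.mem_of_tendsto (hy {n}) (Eventually.of_forall fun m => ?_)
    refine Submodule.sum_mem _ fun k _ => ?_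
    rw [partialSum_apply, Finset.sum_singleton]
    exact Submodule.smul_mem _ _ (Submodule.mem_span_singleton_self _)
  choose a ha using hline
  have hya : ∀ s, y s = ∑ n ∈ s, a n • b n := by
    intro s
    refine tendsto_nhds_unique (hy s) ?_
    simp only [ha]
    refine (tendsto_finsetSum s fun n _ => hy {n}).congr fun m => ?_
    rw [Finset.sum_comm]
    simp [partialSum_apply]
  have hpow : Tendsto (fun m => κ ^ 2 * (2 * κ ^ 2 * (c * M) * (2 * κ)⁻¹ ^ m) +
      κ * (M * (2 * κ)⁻¹ ^ m)) atTop (𝓝 0) := by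
    have h1 : (2 * κ)⁻¹ < 1 := inv_lt_one_of_one_lt₀ (by linarith)
    have h2 := tendsto_pow_atTop_nhds_zero_of_lt_one (by positivity) h1
    simpa using ((h2.const_mul (2 * κ ^ 2 * (c * M))).const_mul (κ ^ 2)).add
      ((h2.const_mul M).const_mul κ)
  -- Uniformly in `s`, `y s` is close to the partial sum of `f - r m` once `m` is large. For that
  -- fixed `m` the partial sums converge to `f - r m`, which is close to `f`. Uniqueness of
  -- expansions then identifies `a` with the coordinates of `f`.
  have hf : HasSum (fun n => a n • b n) f := by
    refine (tendsto_iff_qnorm (𝕜 := 𝕜)).2 fun ε hε => ?_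
    obtain ⟨m, hm⟩ := (hpow.eventually_lt_const (half_pos hε)).exists
    have hpart := (tendsto_iff_qnorm (𝕜 := 𝕜)).1
      (hb.hasSum_coord (f - r m)) (ε / (2 * κ ^ 2)) (by positivity)
    filter_upwards [hpart] with s hs
    rw [← partialSum_apply] at hs
    rw [← hya]
    have e : y s - f = (y s - hb.partialSum s (f - r m) + (hb.partialSum s (f - r m) - (f - r m)))
        + -r m := by abel
    have h1 : qnorm 𝕜 (y s - hb.partialSum s (f - r m)) ≤
        2 * κ ^ 2 * (c * M) * (2 * κ)⁻¹ ^ m := by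
      rw [← hsum, map_sum]
      exact hy' s m
    have hs' : qnorm 𝕜 (hb.partialSum s (f - r m) - (f - r m)) * (2 * κ ^ 2) < ε :=
      (lt_div_iff₀ (by positivity)).1 hs
    rw [e]
    refine (hq _ _).trans_lt ?_
    rw [qnorm_neg]
    calc _ ≤ κ * (κ * (2 * κ ^ 2 * (c * M) * (2 * κ)⁻¹ ^ m +
          qnorm 𝕜 (hb.partialSum s (f - r m) - (f - r m))) + M * (2 * κ)⁻¹ ^ m) := by
          gcongr
          · exact (hq _ _).trans (by gcongr)
          · exact hr m
      _ < ε := by nlinarith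
  have hfin : hb.partialSum s f = y s := by
    rw [partialSum_apply, hya]
    exact Finset.sum_congr rfl fun n _ => by rw [hb.coord_eq hf]
  -- The remainder estimate after zero terms bounds the whole sum.
  have h := hy' s 0
  simp only [Finset.range_zero, Finset.sum_empty, sub_zero, pow_zero, mul_one] at h
  rw [hfin]
  exact h.trans_eq (by ring)

theorem continuous_coord (hb : IsUnconditionalBasis 𝕜 b) (n : ι) : Continuous (hb.coord n) := by
  obtain ⟨C, -, hC⟩ := hb.exists_partialSum_bound
  have h0 : 0 < qnorm 𝕜 (b n) :=
    lt_of_le_of_ne (qnorm_nonneg _) fun h => hb.ne_zero n ((qnorm_eq_zero _).1 h.symm)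
  refine continuous_of_bound (𝕜 := 𝕜) _ (C / qnorm 𝕜 (b n)) fun f => ?_
  have h := hC {n} f
  rw [partialSum_apply, Finset.sum_singleton, qnorm_smul] at h
  rw [div_mul_eq_mul_div, le_div_iff₀ h0]
  exact h

/-- The coordinate functionals as continuous linear maps. -/
noncomputable def coordL (hb : IsUnconditionalBasis 𝕜 b) (n : ι) : E →L[𝕜] 𝕜 :=
  ⟨hb.coord n, hb.continuous_coord n⟩

/-- Every set of indices defines a bounded coordinate projection. -/
theorem exists_projection (hb : IsUnconditionalBasis 𝕜 b) (A : Set ι) :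
    ∃ P : E →L[𝕜] E, (∀ n ∈ A, P (b n) = b n) ∧ ∀ n ∉ A, P (b n) = 0 := by
  classical
  obtain ⟨κ, hκ, hq⟩ := exists_modulus (𝕜 := 𝕜) (X := E)
  obtain ⟨C, -, hC⟩ := hb.exists_partialSum_bound
  have := t2Space 𝕜 E
  -- In a complete group every subfamily of a summable family is summable.
  have hsummable : ∀ f, Summable (A.indicator fun n => hb.coord n f • b n) := by
    let _ := IsTopologicalAddGroup.rightUniformSpace E
    have : IsUniformAddGroup E := isUniformAddGroup_of_addCommGroup
    have := completeSpace 𝕜 E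
    exact fun f => (hb.hasSum_coord f).summable.indicator A
  let P : E →ₗ[𝕜] E :=
    { toFun := fun f => ∑' n, A.indicator (fun n => hb.coord n f • b n) n
      map_add' := fun f g => by
        rw [← (hsummable f).tsum_add (hsummable g)]
        exact tsum_congr fun n => by by_cases h : n ∈ A <;> simp [h, add_smul]
      map_smul' := fun c f => by
        rw [RingHom.id_apply, ← (hsummable f).tsum_const_smul c]
        exact tsum_congr fun n => by by_cases h : n ∈ A <;> simp [h, mul_smul] }
  have hP : Continuous P := by
    refine continuous_of_bound (𝕜 := 𝕜) P (κ * C) fun f => ?_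
    rw [mul_assoc]
    refine qnorm_le_of_tendsto hκ hq (hsummable f).hasSum (Eventually.of_forall fun s => ?_)
    have : ∑ n ∈ s, A.indicator (fun n => hb.coord n f • b n) n =
        hb.partialSum (s.filter (· ∈ A)) f := by
      rw [partialSum_apply, Finset.sum_filter]
      rfl
    rw [this]
    exact hC _ f
  have hPb : ∀ n, P (b n) = A.indicator b n := by
    intro n
    change ∑' m, A.indicator (fun m => hb.coord m (b n) • b m) m = _
    rw [tsum_eq_single n fun m hm => by simp [hb.coord_apply, hm]]
    by_cases h : n ∈ A <;> simp [h, hb.coord_apply]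
  exact ⟨⟨P, hP⟩, fun n hn => by simpa [hn] using hPb n, fun n hn => by simpa [hn] using hPb n⟩

end IsUnconditionalBasis

/-! ### Extending operators to the Banach envelope -/

section EnvelopeExtension

open QuasiBanachSpace

variable (𝕜 : Type*) [RCLike 𝕜]
  (X : Type*) [AddCommGroup X] [Module 𝕜 X] [TopologicalSpace X] [IsTopologicalAddGroup X]
  [ContinuousSMul 𝕜 X] [QuasiBanachSpace 𝕜 X]
  (U : Type*) [NormedAddCommGroup U] [NormedSpace 𝕜 U]

/-- The envelope map as a continuous linear map. -/
noncomputable def envelopeMapL : X →L[𝕜] BanachEnvelope 𝕜 X :=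
  ⟨envelopeMap 𝕜 X, continuous_of_bound (𝕜 := 𝕜) (envelopeMap 𝕜 X) 1 fun x => by
    rw [one_mul]
    exact norm_envelopeMap_le x⟩

theorem denseRange_envelopeMapL : DenseRange (envelopeMapL 𝕜 X) :=
  UniformSpace.Completion.denseRange_coe (α := PreEnvelope 𝕜 X)

/-- The envelope map of the direct sum of a quasi-Banach space and a Banach space. -/
noncomputable def envelopeProd : (X × U) →L[𝕜] (BanachEnvelope 𝕜 X × U) :=
  (envelopeMapL 𝕜 X).prodMap (ContinuousLinearMap.id 𝕜 U)

theorem denseRange_envelopeProd : DenseRange (envelopeProd 𝕜 X U) :=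
  (denseRange_envelopeMapL 𝕜 X).prodMap Function.surjective_id.denseRange

variable {𝕜 X U} {Y : Type*} [NormedAddCommGroup Y] [NormedSpace 𝕜 Y]

theorem envelopeProd_ext {S T : (BanachEnvelope 𝕜 X × U) →L[𝕜] Y}
    (h : ∀ x, S (envelopeProd 𝕜 X U x) = T (envelopeProd 𝕜 X U x)) : S = T :=
  ContinuousLinearMap.ext fun z => congrFun
    ((denseRange_envelopeProd 𝕜 X U).equalizer S.continuous T.continuous (funext h)) z

variable [CompleteSpace Y] [CompleteSpace U]

theorem exists_envelopeMapL_lift (T : X →L[𝕜] Y) {C : ℝ} (hC : 0 < C)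
    (hT : ∀ x, ‖T x‖ ≤ C * qnorm 𝕜 x) :
    ∃ S : BanachEnvelope 𝕜 X →L[𝕜] Y,
      (∀ z, ‖S z‖ ≤ C * ‖z‖) ∧ ∀ x, S (envelopeMapL 𝕜 X x) = T x := by
  have hC' : (C : 𝕜) ≠ 0 := by exact_mod_cast hC.ne'
  obtain ⟨S, ⟨hS, hSJ⟩, -⟩ := existsUnique_envelope_lift ((C : 𝕜)⁻¹ • (T : X →ₗ[𝕜] Y))
    fun x => by
      rw [LinearMap.smul_apply, norm_smul, norm_inv, RCLike.norm_ofReal, abs_of_pos hC,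
        inv_mul_le_iff₀ hC]
      exact hT x
  refine ⟨(C : 𝕜) • S.mkContinuous 1 (by simpa using hS), fun z => ?_, fun x => ?_⟩
  · rw [smul_apply, norm_smul, RCLike.norm_ofReal, abs_of_pos hC]
    exact mul_le_mul_of_nonneg_left (hS z) hC.le
  · have h : S (envelopeMapL 𝕜 X x) = (C : 𝕜)⁻¹ • T x := hSJ x
    simp [h, hC']

/-- Only the summand `X` needs the universal property, since `U` is already Banach; adding the two
components costs the factor `2`. The explicit constant is what transfers uniform bounds on the
partial sums to the envelope. -/
theorem exists_envelopeProd_lift (T : (X × U) →L[𝕜] Y) {C : ℝ} (hC : 0 < C)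
    (hT : ∀ x, ‖T x‖ ≤ C * qnorm 𝕜 x) :
    ∃ S : (BanachEnvelope 𝕜 X × U) →L[𝕜] Y,
      (∀ z, ‖S z‖ ≤ 2 * C * ‖z‖) ∧ ∀ x, S (envelopeProd 𝕜 X U x) = T x := by
  obtain ⟨S, hS, hSJ⟩ := exists_envelopeMapL_lift (T.comp (.inl 𝕜 X U)) hC fun x => by
    refine (hT (x, 0)).trans_eq ?_
    congr 1
    change max (qnorm 𝕜 x) (qnorm 𝕜 (0 : U)) = _
    rw [qnorm_zero, max_eq_left (qnorm_nonneg x)]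
  have hU : ∀ u : U, ‖T (0, u)‖ ≤ C * ‖u‖ := fun u => by
    refine (hT (0, u)).trans_eq ?_
    congr 1
    change max (qnorm 𝕜 (0 : X)) ‖u‖ = _
    rw [qnorm_zero, max_eq_right (norm_nonneg u)]
  refine ⟨S.comp (.fst 𝕜 _ U) + (T.comp (.inr 𝕜 X U)).comp (.snd 𝕜 (BanachEnvelope 𝕜 X) U),
    fun z => ?_, fun x => ?_⟩
  · calc ‖S z.1 + T (0, z.2)‖ ≤ C * ‖z.1‖ + C * ‖z.2‖ :=
          (norm_add_le _ _).trans (add_le_add (hS _) (hU _))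
      _ ≤ C * ‖z‖ + C * ‖z‖ := by
          gcongr
          · exact norm_fst_le z
          · exact norm_snd_le z
      _ = 2 * C * ‖z‖ := by ring
  · change S (envelopeMapL 𝕜 X x.1) + T (0, x.2) = T x
    rw [hSJ]
    change T (x.1, 0) + T (0, x.2) = T x
    rw [← map_add]
    simp

/-! ### Functoriality of the extension -/

theorem exists_envelopeProd_map (T : (X × U) →L[𝕜] (X × U)) :
    ∃ S : (BanachEnvelope 𝕜 X × U) →L[𝕜] (BanachEnvelope 𝕜 X × U),
      ∀ x, S (envelopeProd 𝕜 X U x) = envelopeProd 𝕜 X U (T x) := by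
  let T' : (X × U) →L[𝕜] (BanachEnvelope 𝕜 X × U) := (envelopeProd 𝕜 X U).comp T
  obtain ⟨C, hC, hT⟩ := exists_bound (𝕜 := 𝕜) T'
  obtain ⟨S, -, hS⟩ := exists_envelopeProd_lift T' hC hT
  exact ⟨S, hS⟩

/-- The extension of an operator on `X ⊕ U` to the Banach envelope. -/
noncomputable def envelopeProdMap (T : (X × U) →L[𝕜] (X × U)) :
    (BanachEnvelope 𝕜 X × U) →L[𝕜] (BanachEnvelope 𝕜 X × U) :=
  (exists_envelopeProd_map T).choose

theorem envelopeProdMap_apply (T : (X × U) →L[𝕜] (X × U)) (x : X × U) :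
    envelopeProdMap T (envelopeProd 𝕜 X U x) = envelopeProd 𝕜 X U (T x) :=
  (exists_envelopeProd_map T).choose_spec x

/-- Multiplicativity carries idempotents, and equivalences between them, over to the envelope. -/
theorem envelopeProdMap_mul (S T : (X × U) →L[𝕜] (X × U)) :
    envelopeProdMap (S * T) = envelopeProdMap S * envelopeProdMap T :=
  envelopeProd_ext fun x => by
    simp only [mul_apply_eq_comp, envelopeProdMap_apply]

theorem envelopeProdMap_one_sub (T : (X × U) →L[𝕜] (X × U)) :
    envelopeProdMap (1 - T) = 1 - envelopeProdMap T :=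
  envelopeProd_ext fun x => by
    simp only [envelopeProdMap_apply, sub_apply,
      one_apply_eq_self, map_sub]

theorem exists_envelopeMapL_map (T : X →L[𝕜] X) :
    ∃ S : BanachEnvelope 𝕜 X →L[𝕜] BanachEnvelope 𝕜 X,
      ∀ x, S (envelopeMapL 𝕜 X x) = envelopeMapL 𝕜 X (T x) := by
  let T' : X →L[𝕜] BanachEnvelope 𝕜 X := (envelopeMapL 𝕜 X).comp T
  obtain ⟨C, hC, hT⟩ := exists_bound (𝕜 := 𝕜) T'
  obtain ⟨S, -, hS⟩ := exists_envelopeMapL_lift T' hC hT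
  exact ⟨S, hS⟩

/-- A continuous functional vanishes where the envelope map does. -/
theorem apply_eq_zero_of_envelopeMapL_eq_zero (T : X →L[𝕜] 𝕜) {x : X}
    (hx : envelopeMapL 𝕜 X x = 0) : T x = 0 := by
  obtain ⟨C, hC, hT⟩ := exists_bound (𝕜 := 𝕜) T
  obtain ⟨S, -, hS⟩ := exists_envelopeMapL_lift T hC hT
  rw [← hS, hx, map_zero]

/-! ### Unconditional bases under the envelope map -/

variable {ι : Type*} {b : ι → X × U}

/-- Every continuous functional, in particular every coordinate, factors through the envelope. A
vector killed by the envelope map therefore has zero expansion. -/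
theorem IsUnconditionalBasis.injective_envelopeMapL (hb : IsUnconditionalBasis 𝕜 b) :
    Function.Injective (envelopeMapL 𝕜 X) := by
  refine (injective_iff_map_eq_zero _).2 fun x hx => ?_
  have := t2Space 𝕜 (X × U)
  have hcoord : ∀ n, hb.coord n (x, 0) = 0 := fun n =>
    apply_eq_zero_of_envelopeMapL_eq_zero ((hb.coordL n).comp (.inl 𝕜 X U)) hx
  have h := hb.hasSum_coord (x, 0)
  simp only [hcoord, zero_smul] at h
  exact congrArg Prod.fst (h.unique hasSum_zero)

/-- An unconditional basis of `X ⊕ U` is mapped to an unconditional basis of the envelope. -/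
theorem IsUnconditionalBasis.envelopeProd (hb : IsUnconditionalBasis 𝕜 b) :
    IsUnconditionalBasis 𝕜 (fun n => envelopeProd 𝕜 X U (b n)) := by
  classical
  set J := _root_.envelopeProd 𝕜 X U with hJ
  obtain ⟨C, hC, hpart⟩ := hb.exists_partialSum_bound
  obtain ⟨D, hD, hJD⟩ := exists_bound (𝕜 := 𝕜) J
  have hlift : ∀ n, ∃ φ : (BanachEnvelope 𝕜 X × U) →L[𝕜] 𝕜, ∀ x, φ (J x) = hb.coord n x := by
    intro n
    obtain ⟨K, hK, hbd⟩ := exists_bound (𝕜 := 𝕜) (hb.coordL n)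
    obtain ⟨S, -, hS⟩ := exists_envelopeProd_lift (hb.coordL n) hK hbd
    exact ⟨S, hS⟩
  choose φ hφ using hlift
  have hbound : ∀ (s : Finset ι) z, ‖∑ n ∈ s, φ n z • J (b n)‖ ≤ 2 * (D * C) * ‖z‖ := by
    intro s
    let T : (X × U) →L[𝕜] (BanachEnvelope 𝕜 X × U) :=
      ∑ n ∈ s, (hb.coordL n).smulRight (J (b n))
    have hT : ∀ x, T x = J (hb.partialSum s x) := fun x => by
      rw [hb.partialSum_apply, map_sum]
      simp only [T, sum_apply, map_smul]
      rfl
    obtain ⟨S, hS, hSJ⟩ := exists_envelopeProd_lift T (mul_pos hD hC) fun x => by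
      rw [hT, mul_assoc]
      exact (hJD _).trans (mul_le_mul_of_nonneg_left (hpart s x) hD.le)
    -- By density, the bounded extension of the partial sum operator is the partial sum operator
    -- built from the `φ n`, so the bound is independent of `s`.
    have hS' : S = ∑ n ∈ s, (φ n).smulRight (J (b n)) := envelopeProd_ext fun x => by
      rw [hSJ, hT, hb.partialSum_apply, map_sum]
      simp only [sum_apply, ContinuousLinearMap.smulRight_apply, map_smul,
        ← hJ, hφ]
    intro z
    have := hS z
    rw [hS'] at this
    simpa using this
  have hsum : ∀ z, HasSum (fun n => φ n z • J (b n)) z := by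
    intro z
    refine Metric.tendsto_nhds.2 fun ε hε => ?_
    set K := 2 * (D * C) with hK
    have hK0 : 0 < K := by positivity
    obtain ⟨x, hx⟩ := (denseRange_envelopeProd 𝕜 X U).exists_dist_lt z
      (show 0 < ε / (2 * (K + 1)) by positivity)
    have hx1 : HasSum (fun n => φ n (J x) • J (b n)) (J x) := by
      have := (hb.hasSum_coord x).mapL J
      simpa only [hφ, map_smul] using this
    filter_upwards [Metric.tendsto_nhds.1 hx1 (ε / 2) (half_pos hε)] with s hs
    rw [dist_eq_norm] at hx hs ⊢
    -- The outer terms contribute at most `(K + 1) * ‖z - J x‖ < ε / 2`, the middle one less than `ε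
    -- / 2`.
    have e : ∑ n ∈ s, φ n z • J (b n) - z = ∑ n ∈ s, φ n (z - J x) • J (b n) +
        (∑ n ∈ s, φ n (J x) • J (b n) - J x) + (J x - z) := by
      simp only [map_sub, sub_smul, Finset.sum_sub_distrib]
      abel
    rw [e]
    have h1 := hbound s (z - J x)
    have hx' : ‖z - J x‖ * (2 * (K + 1)) < ε := (lt_div_iff₀ (by positivity)).1 hx
    have h2 := norm_sub_rev (J x) z
    refine (norm_add₃_le).trans_lt ?_
    nlinarith
  refine ⟨hb.countable, ?_, fun z => ⟨fun n => φ n z, hsum z, fun a ha => funext fun m => ?_⟩⟩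
  · refine eq_top_iff.2 fun z _ => ?_
    refine mem_closure_of_tendsto (hsum z) (Eventually.of_forall fun s => ?_)
    exact Submodule.sum_mem _ fun n _ => Submodule.smul_mem _ _
      (Submodule.subset_span ⟨n, trivial, rfl⟩)
  · have h := ha.mapL (φ m)
    have h' := hasSum_single (f := fun n => φ m (a n • J (b n))) m fun n hn => by
      simp [hφ, hb.coord_apply, hn.symm]
    have := h.unique h'
    simpa [hφ, hb.coord_apply] using this.symm

end EnvelopeExtension

/-! ### Idempotent operators and their ranges -/

section Idempotents

/-- Two idempotents of which one is conjugate to one with the same range as the other are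
Murray-von Neumann equivalent. -/
theorem exists_mul_eq_of_conj {R : Type*} [Ring R] {p q t t' : R} (ht' : t' * t = 1)
    (hp : p * p = p) (hq : q * q = q) (h₁ : t * p * t' * q = q)
    (h₂ : q * (t * p * t') = t * p * t') : ∃ c d, d * c = p ∧ c * d = q := by
  have h : q * t * p = t * p := by
    have := congrArg (· * t) h₂
    simpa only [mul_assoc, ht', mul_one] using this
  refine ⟨q * t * p, p * t' * q, ?_, ?_⟩
  · calc p * t' * q * (q * t * p) = p * t' * ((q * q) * t * p) := by simp only [mul_assoc]
      _ = p * (t' * t) * p := by rw [hq, h]; simp only [mul_assoc]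
      _ = p := by rw [ht', mul_one, hp]
  · calc q * t * p * (p * t' * q) = q * (t * (p * p) * t' * q) := by simp only [mul_assoc]
      _ = q := by rw [hp, h₁, hq]

/-- The complementary idempotents are Murray-von Neumann equivalent as well. -/
theorem exists_mul_eq_one_sub_of_conj {R : Type*} [Ring R] {p q t t' : R} (ht : t * t' = 1)
    (ht' : t' * t = 1) (hp : p * p = p) (hq : q * q = q) (h₁ : t * p * t' * q = q)
    (h₂ : q * (t * p * t') = t * p * t') : ∃ c d, d * c = 1 - p ∧ c * d = 1 - q := by
  have h : q * t * p = t * p := by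
    have := congrArg (· * t) h₂
    simpa only [mul_assoc, ht', mul_one] using this
  have h' : p * t' * q = t' * q := by
    have := congrArg (t' * ·) h₁
    simpa only [← mul_assoc, ht', one_mul] using this
  -- The kernels of `t * p * t'` and `q` may differ, but both are complements of the same range.
  -- Compressing `t` and `t'` to the kernels gives mutually inverse maps.
  refine ⟨(1 - q) * t * (1 - p), (1 - p) * t' * (1 - q), ?_, ?_⟩
  · have e : (1 - p) * t' * (1 - q) = (1 - p) * t' := by
      have : (1 - p) * t' * q = 0 := by simp only [sub_mul, one_mul, h', sub_self]
      rw [mul_sub, this, mul_one, sub_zero]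
    calc (1 - p) * t' * (1 - q) * ((1 - q) * t * (1 - p))
        = (1 - p) * t' * (1 - q) * (1 - q) * t * (1 - p) := by simp only [mul_assoc]
      _ = (1 - p) * (t' * t) * (1 - p) := by rw [e, e]; simp only [mul_assoc]
      _ = 1 - p := by rw [ht', mul_one]; simp [sub_mul, mul_sub, hp]
  · have e : (1 - q) * t * (1 - p) = (1 - q) * t := by
      have : (1 - q) * t * p = 0 := by simp only [sub_mul, one_mul, h, sub_self]
      rw [mul_sub, this, mul_one, sub_zero]
    calc (1 - q) * t * (1 - p) * ((1 - p) * t' * (1 - q))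
        = (1 - q) * t * (1 - p) * (1 - p) * t' * (1 - q) := by simp only [mul_assoc]
      _ = (1 - q) * (t * t') * (1 - q) := by rw [e, e]; simp only [mul_assoc]
      _ = 1 - q := by rw [ht, mul_one]; simp [sub_mul, mul_sub, hq]

/-! ### Ranges of idempotents and complemented subspaces -/

variable {𝕜 : Type*} [RCLike 𝕜]
  {E : Type*} [AddCommGroup E] [Module 𝕜 E] [TopologicalSpace E]
  {F : Type*} [AddCommGroup F] [Module 𝕜 F] [TopologicalSpace F]

theorem mem_range_iff_of_mul_self {P : E →L[𝕜] E} (hP : P * P = P) {x : E} :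
    x ∈ LinearMap.range (P : E →ₗ[𝕜] E) ↔ P x = x := by
  constructor
  · rintro ⟨y, rfl⟩
    exact DFunLike.congr_fun hP y
  · exact fun h => ⟨x, h⟩

/-- The maps `c` and `d`, compressed to the ranges, are mutually inverse. The hypotheses are
identities between operators on the whole space, a form that extension to the envelope preserves. -/
theorem nonempty_range_equiv_of_mul_eq {P Q c d : E →L[𝕜] E} (hP : P * P = P) (hQ : Q * Q = Q)
    (h₁ : d * c = P) (h₂ : c * d = Q) :
    Nonempty (LinearMap.range (P : E →ₗ[𝕜] E) ≃L[𝕜] LinearMap.range (Q : E →ₗ[𝕜] E)) := by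
  have hdc : ∀ x, d (c x) = P x := DFunLike.congr_fun h₁
  have hcd : ∀ x, c (d x) = Q x := DFunLike.congr_fun h₂
  let f : LinearMap.range (P : E →ₗ[𝕜] E) →L[𝕜] LinearMap.range (Q : E →ₗ[𝕜] E) :=
    ((Q.comp c).comp (Submodule.subtypeL _)).codRestrict _ fun x => ⟨c x, rfl⟩
  let g : LinearMap.range (Q : E →ₗ[𝕜] E) →L[𝕜] LinearMap.range (P : E →ₗ[𝕜] E) :=
    ((P.comp d).comp (Submodule.subtypeL _)).codRestrict _ fun x => ⟨d x, rfl⟩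
  refine ⟨.equivOfInverse f g (fun x => Subtype.ext ?_) (fun y => Subtype.ext ?_)⟩
  · change P (d (Q (c x))) = x
    have hx : P x = x := (mem_range_iff_of_mul_self hP).1 x.2
    rw [← hcd, hdc, hdc, hx, hx, hx]
  · change Q (c (P (d y))) = y
    have hy : Q y = y := (mem_range_iff_of_mul_self hQ).1 y.2
    rw [← hdc, hcd, hcd, hy, hy, hy]

theorem nonempty_range_prodMap_equiv (P : E →L[𝕜] E) (Q : F →L[𝕜] F) :
    Nonempty (LinearMap.range (P.prodMap Q : (E × F) →ₗ[𝕜] (E × F)) ≃L[𝕜]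
      (LinearMap.range (P : E →ₗ[𝕜] E) × LinearMap.range (Q : F →ₗ[𝕜] F))) := by
  refine ⟨.equivOfInverse
    ((((ContinuousLinearMap.fst 𝕜 E F).comp (Submodule.subtypeL _)).codRestrict _ ?_).prod
      (((ContinuousLinearMap.snd 𝕜 E F).comp (Submodule.subtypeL _)).codRestrict _ ?_))
    (((Submodule.subtypeL _).prodMap (Submodule.subtypeL _)).codRestrict _ ?_)
    (fun _ => rfl) (fun _ => rfl)⟩
  · rintro ⟨_, ⟨z, rfl⟩⟩
    exact ⟨z.1, rfl⟩
  · rintro ⟨_, ⟨z, rfl⟩⟩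
    exact ⟨z.2, rfl⟩
  · rintro ⟨⟨_, ⟨x, rfl⟩⟩, ⟨_, ⟨y, rfl⟩⟩⟩
    exact ⟨(x, y), rfl⟩

theorem nonempty_equiv_range_prod_range [IsTopologicalAddGroup E] {P : E →L[𝕜] E}
    (hP : P * P = P) :
    Nonempty (E ≃L[𝕜] (LinearMap.range (P : E →ₗ[𝕜] E) ×
      LinearMap.range ((1 - P : E →L[𝕜] E) : E →ₗ[𝕜] E))) := by
  have hP' : (1 - P) * (1 - P) = 1 - P := by simp [sub_mul, mul_sub, hP]
  refine ⟨.equivOfInverse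
    ((P.codRestrict (LinearMap.range (P : E →ₗ[𝕜] E)) fun x => ⟨x, rfl⟩).prod
      ((1 - P).codRestrict (LinearMap.range ((1 - P : E →L[𝕜] E) : E →ₗ[𝕜] E)) fun x => ⟨x, rfl⟩))
    ((Submodule.subtypeL _).coprod (Submodule.subtypeL _)) (fun x => ?_) (fun z => ?_)⟩
  · change P x + (x - P x) = x
    abel
  · obtain ⟨⟨x, hx⟩, ⟨y, hy⟩⟩ := z
    rw [mem_range_iff_of_mul_self hP] at hx
    rw [mem_range_iff_of_mul_self hP'] at hy
    have hy' : P y = 0 := sub_eq_self.1 (show y - P y = y from hy)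
    refine Prod.ext (Subtype.ext ?_) (Subtype.ext ?_)
    · change P (x + y) = x
      rw [map_add, hx, hy', add_zero]
    · change x + y - P (x + y) = y
      rw [map_add, hx, hy']
      abel

theorem Submodule.ClosedComplemented.exists_idempotent {V : Submodule 𝕜 E}
    (hV : V.ClosedComplemented) :
    ∃ P : E →L[𝕜] E, P * P = P ∧ LinearMap.range (P : E →ₗ[𝕜] E) = V := by
  obtain ⟨f, hf⟩ := hV
  refine ⟨V.subtypeL.comp f, ContinuousLinearMap.ext fun x => ?_, le_antisymm ?_ fun x hx => ?_⟩
  · change (f (f x) : E) = f x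
    rw [hf]
  · rintro _ ⟨x, rfl⟩
    exact (f x).2
  · exact ⟨x, congrArg Subtype.val (hf ⟨x, hx⟩)⟩

theorem closedComplemented_range_of_mul_self {P : E →L[𝕜] E} (hP : P * P = P) :
    (LinearMap.range (P : E →ₗ[𝕜] E)).ClosedComplemented :=
  ⟨P.codRestrict _ fun x => ⟨x, rfl⟩,
    fun x => Subtype.ext ((mem_range_iff_of_mul_self hP).1 x.2)⟩

theorem exists_closedComplemented_equiv {Z : Type*} [AddCommGroup Z] [Module 𝕜 Z]
    [TopologicalSpace Z] (i : Z →L[𝕜] E) (p : E →L[𝕜] Z) (h : ∀ z, p (i z) = z) :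
    ∃ V : Submodule 𝕜 E, V.ClosedComplemented ∧ Nonempty (Z ≃L[𝕜] V) := by
  refine ⟨LinearMap.range (i : Z →ₗ[𝕜] E), ⟨(i.comp p).codRestrict _ fun x => ⟨p x, rfl⟩, ?_⟩,
    ⟨.equivOfInverse (i.codRestrict _ fun z => ⟨z, rfl⟩) (p.comp (Submodule.subtypeL _)) h ?_⟩⟩
  · rintro ⟨_, ⟨z, rfl⟩⟩
    exact Subtype.ext (congrArg i (h z))
  · rintro ⟨_, ⟨z, rfl⟩⟩
    exact Subtype.ext (congrArg i (h z))

/-- A space isomorphic to complemented subspaces of two complementably incomparable spaces is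
finite-dimensional. -/
theorem ComplementablyIncomparable.finiteDimensional [IsTopologicalAddGroup E]
    [ContinuousSMul 𝕜 E] [IsTopologicalAddGroup F] [ContinuousSMul 𝕜 F]
    (hEF : ComplementablyIncomparable 𝕜 E F) {Z : Type*} [AddCommGroup Z] [Module 𝕜 Z]
    [TopologicalSpace Z] (i : Z →L[𝕜] E) (p : E →L[𝕜] Z) (h : ∀ z, p (i z) = z)
    (i' : Z →L[𝕜] F) (p' : F →L[𝕜] Z) (h' : ∀ z, p' (i' z) = z) : FiniteDimensional 𝕜 Z := by
  obtain ⟨V, hV, ⟨e⟩⟩ := exists_closedComplemented_equiv i p h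
  obtain ⟨W, hW, ⟨e'⟩⟩ := exists_closedComplemented_equiv i' p' h'
  have := hEF V W hV hW ⟨e.symm.trans e'⟩
  exact e.symm.toLinearEquiv.finiteDimensional

/-- One-dimensional summands can be cancelled. -/
theorem nonempty_equiv_of_prod_equiv [IsTopologicalAddGroup E] [ContinuousSMul 𝕜 E]
    [IsTopologicalAddGroup F] [ContinuousSMul 𝕜 F]
    (e : (E × 𝕜) ≃L[𝕜] (F × 𝕜)) : Nonempty (E ≃L[𝕜] F) := by
  let f : (E × 𝕜) →L[𝕜] 𝕜 := .snd 𝕜 E 𝕜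
  let g : (E × 𝕜) →L[𝕜] 𝕜 := (ContinuousLinearMap.snd 𝕜 F 𝕜).comp (e : (E × 𝕜) →L[𝕜] (F × 𝕜))
  -- Two proper subspaces, here the kernels of `f` and `g`, do not cover the space.
  obtain ⟨u, hfu, hgu⟩ : ∃ u, f u ≠ 0 ∧ g u ≠ 0 := by
    have hf : f (0, 1) ≠ 0 := one_ne_zero
    have hg : g (e.symm (0, 1)) ≠ 0 := by simp [g]
    by_cases h1 : g (0, 1) = 0
    · by_cases h2 : f (e.symm (0, 1)) = 0
      · exact ⟨(0, 1) + e.symm (0, 1), by rwa [map_add, h2, add_zero],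
          by rwa [map_add, h1, zero_add]⟩
      · exact ⟨_, h2, hg⟩
    · exact ⟨_, hf, h1⟩
  -- both spaces are complements of the line spanned by `u`
  let P : (E × 𝕜) →L[𝕜] (E × 𝕜) := .id 𝕜 _ - ((f u)⁻¹ • f).smulRight u
  let Q : (E × 𝕜) →L[𝕜] (E × 𝕜) := .id 𝕜 _ - ((g u)⁻¹ • g).smulRight u
  have hPa : ∀ z, P z = z - ((f u)⁻¹ * f z) • u := fun z => rfl
  have hQa : ∀ z, Q z = z - ((g u)⁻¹ * g z) • u := fun z => rfl
  have hfP : ∀ z, f (P z) = 0 := fun z => by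
    rw [hPa, map_sub, map_smul, smul_eq_mul]
    field_simp
    ring
  have hgQ : ∀ z, g (Q z) = 0 := fun z => by
    rw [hQa, map_sub, map_smul, smul_eq_mul]
    field_simp
    ring
  -- `P` and `Q` project along `u` onto the kernels of `f` and `g`, which are copies of `E` and `F`;
  -- restricted to these kernels they invert each other.
  have hPQ : ∀ z, f z = 0 → P (Q z) = z := fun z hz => by
    rw [hPa, hQa, map_sub, map_smul, smul_eq_mul, hz, zero_sub, mul_neg, neg_smul, mul_comm (f u)⁻¹,
      mul_assoc, mul_inv_cancel₀ hfu]
    simp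
  have hQP : ∀ z, g z = 0 → Q (P z) = z := fun z hz => by
    rw [hQa, hPa, map_sub, map_smul, smul_eq_mul, hz, zero_sub, mul_neg, neg_smul, mul_comm (g u)⁻¹,
      mul_assoc, mul_inv_cancel₀ hgu]
    simp
  refine ⟨.equivOfInverse
    ((ContinuousLinearMap.fst 𝕜 F 𝕜).comp ((e : (E × 𝕜) →L[𝕜] (F × 𝕜)).comp
      (Q.comp (.inl 𝕜 E 𝕜))))
    ((ContinuousLinearMap.fst 𝕜 E 𝕜).comp (P.comp
      ((e.symm : (F × 𝕜) →L[𝕜] (E × 𝕜)).comp (.inl 𝕜 F 𝕜)))) (fun x => ?_) (fun y => ?_)⟩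
  · change (P (e.symm ((e (Q (x, 0))).1, 0))).1 = x
    have h : ((e (Q (x, 0))).1, (0 : 𝕜)) = e (Q (x, 0)) := Prod.ext rfl (hgQ (x, 0)).symm
    rw [h, e.symm_apply_apply, hPQ _ rfl]
  · change (e (Q ((P (e.symm (y, 0))).1, 0))).1 = y
    have h : ((P (e.symm (y, 0))).1, (0 : 𝕜)) = P (e.symm (y, 0)) :=
      Prod.ext rfl (hfP (e.symm (y, 0))).symm
    rw [h, hQP _ (by simp [g]), e.apply_symm_apply]

end Idempotents

/-! ### Spans of subfamilies of an unconditional basis -/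

section Spans

open QuasiBanachSpace

variable {𝕜 : Type*} [RCLike 𝕜]
  {E : Type*} [AddCommGroup E] [Module 𝕜 E] [TopologicalSpace E] [IsTopologicalAddGroup E]
  [ContinuousSMul 𝕜 E] {ι : Type*} {b : ι → E}

theorem mem_closedSpan {A : Set ι} {n : ι} (hn : n ∈ A) : b n ∈ closedSpan 𝕜 b A :=
  Submodule.le_topologicalClosure _ (Submodule.subset_span ⟨n, hn, rfl⟩)

theorem closedSpan_le {A : Set ι} {V : Submodule 𝕜 E} (hV : IsClosed (V : Set E))
    (h : ∀ n ∈ A, b n ∈ V) : closedSpan 𝕜 b A ≤ V := by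
  refine Submodule.topologicalClosure_minimal _ (Submodule.span_le.2 ?_) hV
  rintro _ ⟨n, hn, rfl⟩
  exact h n hn

theorem eq_on_closedSpan {F : Type*} [AddCommGroup F] [Module 𝕜 F] [TopologicalSpace F] [T2Space F]
    {A : Set ι} {S T : E →L[𝕜] F} (h : ∀ n ∈ A, S (b n) = T (b n)) {x : E}
    (hx : x ∈ closedSpan 𝕜 b A) : S x = T x :=
  closedSpan_le (V := LinearMap.eqLocus (S : E →ₗ[𝕜] F) (T : E →ₗ[𝕜] F))
    (isClosed_eq S.continuous T.continuous) h hx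

variable [T2Space E]

theorem mul_self_of_basis_projection (hb : IsUnconditionalBasis 𝕜 b) {A : Set ι} {P : E →L[𝕜] E}
    (h₁ : ∀ n ∈ A, P (b n) = b n) (h₀ : ∀ n ∉ A, P (b n) = 0) : P * P = P := by
  refine ContinuousLinearMap.ext fun x => eq_on_closedSpan (b := b) (A := Set.univ)
    (fun n _ => ?_) (by rw [hb.closedSpan_eq_top]; trivial)
  change P (P (b n)) = P (b n)
  by_cases hn : n ∈ A
  · rw [h₁ n hn, h₁ n hn]
  · rw [h₀ n hn, map_zero]

theorem range_basis_projection (hb : IsUnconditionalBasis 𝕜 b) {A : Set ι} {P : E →L[𝕜] E}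
    (h₁ : ∀ n ∈ A, P (b n) = b n) (h₀ : ∀ n ∉ A, P (b n) = 0) :
    LinearMap.range (P : E →ₗ[𝕜] E) = closedSpan 𝕜 b A := by
  refine le_antisymm ?_ fun x hx => ⟨x, eq_on_closedSpan (T := .id 𝕜 E) h₁ hx⟩
  rintro _ ⟨x, rfl⟩
  have hx : x ∈ closedSpan 𝕜 b Set.univ := by rw [hb.closedSpan_eq_top]; trivial
  refine closedSpan_le (V := (closedSpan 𝕜 b A).comap (P : E →ₗ[𝕜] E))
    ((Submodule.isClosed_topologicalClosure _).preimage P.continuous) (fun n _ => ?_) hx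
  change P (b n) ∈ closedSpan 𝕜 b A
  by_cases hn : n ∈ A
  · rw [h₁ n hn]
    exact mem_closedSpan hn
  · rw [h₀ n hn]
    exact Submodule.zero_mem _

theorem range_one_sub_basis_projection (hb : IsUnconditionalBasis 𝕜 b) {A : Set ι} {P : E →L[𝕜] E}
    (h₁ : ∀ n ∈ A, P (b n) = b n) (h₀ : ∀ n ∉ A, P (b n) = 0) :
    LinearMap.range ((1 - P : E →L[𝕜] E) : E →ₗ[𝕜] E) = closedSpan 𝕜 b Aᶜ := by
  refine range_basis_projection hb (fun n hn => ?_) (fun n hn => ?_)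
  · change b n - P (b n) = b n
    rw [h₀ n hn, sub_zero]
  · change b n - P (b n) = 0
    rw [h₁ n (not_not.1 hn), sub_self]

variable [QuasiBanachSpace 𝕜 E]

theorem IsUnconditionalBasis.nonempty_closedSpan_insert_equiv (hb : IsUnconditionalBasis 𝕜 b)
    {B : Set ι} {n : ι} (hn : n ∉ B) :
    Nonempty (closedSpan 𝕜 b (insert n B) ≃L[𝕜] (closedSpan 𝕜 b B × 𝕜)) := by
  classical
  obtain ⟨P, h₁, h₀⟩ := hb.exists_projection B
  have hr := range_basis_projection hb h₁ h₀
  have hcoord : ∀ m, hb.coordL n (b m) = if n = m then 1 else 0 := hb.coord_apply n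
  have hmem : ∀ x, P x ∈ closedSpan 𝕜 b B := fun x => hr ▸ ⟨x, rfl⟩
  have hle : closedSpan 𝕜 b B ≤ closedSpan 𝕜 b (insert n B) :=
    closedSpan_le (Submodule.isClosed_topologicalClosure _) fun m hm =>
      mem_closedSpan (Set.mem_insert_of_mem n hm)
  let f : closedSpan 𝕜 b (insert n B) →L[𝕜] (closedSpan 𝕜 b B × 𝕜) :=
    ((P.codRestrict _ hmem).prod (hb.coordL n)).comp (Submodule.subtypeL _)
  let g : (closedSpan 𝕜 b B × 𝕜) →L[𝕜] closedSpan 𝕜 b (insert n B) :=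
    ((Submodule.subtypeL _).coprod ((ContinuousLinearMap.id 𝕜 𝕜).smulRight (b n))).codRestrict _
      fun z => Submodule.add_mem _ (hle z.1.2)
        (Submodule.smul_mem _ _ (mem_closedSpan (Set.mem_insert n B)))
  refine ⟨.equivOfInverse f g (fun x => Subtype.ext ?_) fun z => ?_⟩
  · refine eq_on_closedSpan (S := P + (hb.coordL n).smulRight (b n)) (T := .id 𝕜 E)
      (fun m hm => ?_) x.2
    change P (b m) + hb.coordL n (b m) • b n = b m
    rcases hm with rfl | hm
    · rw [h₀ m hn, hcoord]
      simp
    · rw [h₁ m hm, hcoord, if_neg (ne_of_mem_of_not_mem hm hn).symm]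
      simp
  · obtain ⟨⟨y, hy⟩, c⟩ := z
    have hPy : P y = y := eq_on_closedSpan (T := .id 𝕜 E) h₁ hy
    have hcy : hb.coordL n y = 0 := eq_on_closedSpan (T := 0)
      (fun m hm => by rw [hcoord, if_neg (ne_of_mem_of_not_mem hm hn).symm]; rfl) hy
    refine Prod.ext (Subtype.ext ?_) ?_
    · change P (y + c • b n) = y
      rw [map_add, map_smul, hPy, h₀ n hn, smul_zero, add_zero]
    · change hb.coordL n (y + c • b n) = c
      rw [map_add, map_smul, hcy, hcoord]
      simp

/-- A finite-dimensional summand of `[b n : n ∈ A]` can be moved to the complementary span by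
changing finitely many indices. -/
theorem IsUnconditionalBasis.exists_transfer (hb : IsUnconditionalBasis 𝕜 b)
    {Z : Type*} [AddCommGroup Z] [Module 𝕜 Z] [TopologicalSpace Z] [IsTopologicalAddGroup Z]
    [ContinuousSMul 𝕜 Z] (d : ℕ) (A : Set ι)
    (e : closedSpan 𝕜 b A ≃L[𝕜] (Z × (Fin d → 𝕜))) :
    ∃ B : Set ι, Nonempty (closedSpan 𝕜 b B ≃L[𝕜] Z) ∧
      Nonempty (closedSpan 𝕜 b Bᶜ ≃L[𝕜] (closedSpan 𝕜 b Aᶜ × (Fin d → 𝕜))) := by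
  induction d generalizing A with
  | zero =>
    exact ⟨A, ⟨e.trans (.prodUnique 𝕜 Z (Fin 0 → 𝕜))⟩,
      ⟨(ContinuousLinearEquiv.prodUnique 𝕜 _ (Fin 0 → 𝕜)).symm⟩⟩
  | succ d ih =>
    -- An index is available to move: an empty `A` spans only zero, whereas `Fin (d + 1) → 𝕜` is
    -- nonzero.
    have hA : A.Nonempty := by
      rw [Set.nonempty_iff_ne_empty]
      rintro rfl
      have hbot : closedSpan 𝕜 b ∅ ≤ ⊥ :=
        closedSpan_le (by simp) fun n hn => hn.elim
      have h0 := hbot (e.symm (0, 1)).2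
      have h1 : e.symm (0, 1) = 0 := Subtype.ext ((Submodule.mem_bot 𝕜).1 h0)
      have h2 := (map_eq_zero_iff e.symm e.symm.injective).1 h1
      exact one_ne_zero (congrFun (congrArg Prod.snd h2) 0)
    obtain ⟨n, hn⟩ := hA
    let fin_succ : (Fin (d + 1) → 𝕜) ≃L[𝕜] ((Fin d → 𝕜) × 𝕜) := .ofFinrankEq (by simp)
    obtain ⟨e₁⟩ := hb.nonempty_closedSpan_insert_equiv (B := A \ {n}) (n := n) (by simp)
    obtain ⟨e₂⟩ := hb.nonempty_closedSpan_insert_equiv (B := Aᶜ) (n := n) (by simpa using hn)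
    rw [Set.insert_sdiff_singleton, Set.insert_eq_of_mem hn] at e₁
    have hcompl : (A \ {n})ᶜ = insert n Aᶜ := by
      ext m
      by_cases h : m = n <;> simp [h]
    rw [← hcompl] at e₂
    -- Removing `n` from `A` splits off a line, which cancels against one of the `d + 1` dimensions.
    obtain ⟨e₃⟩ := nonempty_equiv_of_prod_equiv (e₁.symm.trans (e.trans
      ((ContinuousLinearEquiv.prodCongr (.refl 𝕜 Z) fin_succ).trans
        (ContinuousLinearEquiv.prodAssoc 𝕜 Z (Fin d → 𝕜) 𝕜).symm)))
    obtain ⟨B, hB, ⟨e₄⟩⟩ := ih (A \ {n}) e₃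
    refine ⟨B, hB, ⟨e₄.trans ((e₂.prodCongr (.refl 𝕜 _)).trans
      ((ContinuousLinearEquiv.prodAssoc 𝕜 _ _ _).trans (.prodCongr (.refl 𝕜 _)
        ((ContinuousLinearEquiv.prodComm 𝕜 _ _).trans fin_succ.symm))))⟩⟩

end Spans

/-! ### The splitting theorem -/

section Main

open QuasiBanachSpace

theorem exists_equiv_prod_fin {𝕜 F G : Type*} [RCLike 𝕜] [AddCommGroup F] [Module 𝕜 F]
    [TopologicalSpace F] [IsTopologicalAddGroup F] [ContinuousSMul 𝕜 F] [T2Space F]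
    [FiniteDimensional 𝕜 F] [AddCommGroup G] [Module 𝕜 G] [TopologicalSpace G]
    [IsTopologicalAddGroup G] [ContinuousSMul 𝕜 G] [T2Space G] [FiniteDimensional 𝕜 G]
    (h : Module.finrank 𝕜 F ≤ Module.finrank 𝕜 G) :
    ∃ d : ℕ, Nonempty (G ≃L[𝕜] (F × (Fin d → 𝕜))) := by
  obtain ⟨d, hd⟩ := Nat.exists_eq_add_of_le h
  exact ⟨d, ⟨.ofFinrankEq (by simp [hd])⟩⟩

variable {𝕜 : Type*} [RCLike 𝕜]
  {X : Type*} [AddCommGroup X] [Module 𝕜 X] [TopologicalSpace X] [IsTopologicalAddGroup X]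
  [ContinuousSMul 𝕜 X] [QuasiBanachSpace 𝕜 X]
  {U : Type*} [NormedAddCommGroup U] [NormedSpace 𝕜 U] [CompleteSpace U]

/-- If `[b n : n ∈ A]` and its complement differ from `X` and `U` by finite-dimensional summands
only, then a finite change of `A` gives a splitting. -/
theorem IsUnconditionalBasis.exists_splitting_of_finiteDimensional {ι : Type*} {b : ι → X × U}
    (hb : IsUnconditionalBasis 𝕜 b) {A : Set ι} {X₁ F G U₁ : Type*}
    [AddCommGroup X₁] [Module 𝕜 X₁] [TopologicalSpace X₁]
    [AddCommGroup U₁] [Module 𝕜 U₁] [TopologicalSpace U₁]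
    [AddCommGroup F] [Module 𝕜 F] [TopologicalSpace F] [IsTopologicalAddGroup F]
    [ContinuousSMul 𝕜 F] [T2Space F] [FiniteDimensional 𝕜 F]
    [AddCommGroup G] [Module 𝕜 G] [TopologicalSpace G] [IsTopologicalAddGroup G]
    [ContinuousSMul 𝕜 G] [T2Space G] [FiniteDimensional 𝕜 G]
    (eX : X ≃L[𝕜] (X₁ × G)) (eU : U ≃L[𝕜] (F × U₁))
    (eA : closedSpan 𝕜 b A ≃L[𝕜] (X₁ × F)) (eA' : closedSpan 𝕜 b Aᶜ ≃L[𝕜] (G × U₁)) :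
    ∃ B : Set ι, Nonempty (closedSpan 𝕜 b B ≃L[𝕜] X) ∧ Nonempty (closedSpan 𝕜 b Bᶜ ≃L[𝕜] U) := by
  have := t2Space 𝕜 (X × U)
  rcases le_total (Module.finrank 𝕜 G) (Module.finrank 𝕜 F) with h | h
  -- With `F ≃ G ⊕ 𝕜^d`, the span over `A` is `X ⊕ 𝕜^d`; the other span lacks exactly these `d`
  -- dimensions to be `U`.
  · obtain ⟨d, ⟨e⟩⟩ := exists_equiv_prod_fin h
    obtain ⟨B, hB, ⟨e'⟩⟩ := hb.exists_transfer d A (eA.trans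
      ((ContinuousLinearEquiv.prodCongr (.refl 𝕜 X₁) e).trans
        ((ContinuousLinearEquiv.prodAssoc 𝕜 X₁ G (Fin d → 𝕜)).symm.trans
          (eX.symm.prodCongr (.refl 𝕜 _)))))
    refine ⟨B, hB, ⟨e'.trans ((eA'.prodCongr (.refl 𝕜 _)).trans ?_)⟩⟩
    exact ((ContinuousLinearEquiv.prodComm 𝕜 _ _).trans
      ((ContinuousLinearEquiv.prodAssoc 𝕜 _ _ _).symm.trans
        (((ContinuousLinearEquiv.prodComm 𝕜 _ _).trans e.symm).prodCongr (.refl 𝕜 U₁)))).trans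
      eU.symm
  -- Now the surplus lies over `Aᶜ`, so the transfer goes the other way and the resulting set is
  -- complemented.
  · obtain ⟨d, ⟨e⟩⟩ := exists_equiv_prod_fin h
    obtain ⟨B, hB, ⟨e'⟩⟩ := hb.exists_transfer d Aᶜ (eA'.trans
      ((e.prodCongr (.refl 𝕜 U₁)).trans
        (((ContinuousLinearEquiv.prodComm 𝕜 _ _).prodCongr (.refl 𝕜 U₁)).trans
          ((ContinuousLinearEquiv.prodAssoc 𝕜 _ _ _).trans
            ((ContinuousLinearEquiv.prodComm 𝕜 _ _).trans (eU.symm.prodCongr (.refl 𝕜 _)))))))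
    rw [compl_compl] at e'
    refine ⟨Bᶜ, ⟨e'.trans ((eA.prodCongr (.refl 𝕜 _)).trans ?_)⟩, by rwa [compl_compl]⟩
    exact (ContinuousLinearEquiv.prodAssoc 𝕜 _ _ _).trans
      (((ContinuousLinearEquiv.refl 𝕜 X₁).prodCongr e.symm).trans eX.symm)

/-- Splitting for unconditional bases passes from the envelope to the space. No hypothesis on the
spaces with envelope `U` is needed: incomparability makes the summand of `X` inside the span that
corresponds to `U` finite-dimensional, so that this span is locally convex automatically, and a
finite change of the index set corrects the dimensions. -/
theorem splittingForUnconditionalBases_of_envelope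
    (h_compl : SplittingForComplementedSubspaces 𝕜 X U)
    (h_basis : SplittingForUnconditionalBases 𝕜 (BanachEnvelope 𝕜 X) U)
    (h_incomp : ComplementablyIncomparable 𝕜 (BanachEnvelope 𝕜 X) U) :
    SplittingForUnconditionalBases 𝕜 X U := by
  intro ι b hb
  have := t2Space 𝕜 (X × U)
  have := t2Space 𝕜 X
  obtain ⟨A, ⟨eX⟩, ⟨eU⟩⟩ := h_basis ι _ hb.envelopeProd
  obtain ⟨P, hP₁, hP₀⟩ := hb.exists_projection A
  have hPP := mul_self_of_basis_projection hb hP₁ hP₀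
  have hPr := range_basis_projection hb hP₁ hP₀
  have hPr' := range_one_sub_basis_projection hb hP₁ hP₀
  -- the extension of `P` is the corresponding projection of the envelope
  set P' := envelopeProdMap P with hP'
  have hP'₁ : ∀ n ∈ A, P' (envelopeProd 𝕜 X U (b n)) = envelopeProd 𝕜 X U (b n) :=
    fun n hn => by rw [hP', envelopeProdMap_apply, hP₁ n hn]
  have hP'₀ : ∀ n ∉ A, P' (envelopeProd 𝕜 X U (b n)) = 0 :=
    fun n hn => by rw [hP', envelopeProdMap_apply, hP₀ n hn, map_zero]
  have hPP' : P' * P' = P' := by rw [hP', ← envelopeProdMap_mul, hPP]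
  have hP'r := range_basis_projection hb.envelopeProd hP'₁ hP'₀
  have hP'r' := range_one_sub_basis_projection hb.envelopeProd hP'₁ hP'₀
  -- the range of `P` in the given position
  obtain ⟨W₁, W₂, T, hW₁, hW₂, hT⟩ := h_compl _ (closedComplemented_range_of_mul_self hPP)
  obtain ⟨Q₁, hQ₁, rfl⟩ := hW₁.exists_idempotent
  obtain ⟨Q₂, hQ₂, rfl⟩ := hW₂.exists_idempotent
  obtain ⟨R₁, hR₁⟩ := exists_envelopeMapL_map Q₁
  have hRR₁ : R₁ * R₁ = R₁ := by
    refine ContinuousLinearMap.ext fun z => congrFun ((denseRange_envelopeMapL 𝕜 X).equalizer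
      (R₁ * R₁).continuous R₁.continuous (funext fun x => ?_)) z
    change R₁ (R₁ (envelopeMapL 𝕜 X x)) = R₁ (envelopeMapL 𝕜 X x)
    rw [hR₁, hR₁]
    exact congrArg _ (DFunLike.congr_fun hQ₁ x)
  set Q := Q₁.prodMap Q₂ with hQ_def
  have hQQ : Q * Q = Q := ContinuousLinearMap.ext fun x =>
    Prod.ext (DFunLike.congr_fun hQ₁ x.1) (DFunLike.congr_fun hQ₂ x.2)
  have hQ_sub : 1 - Q = (1 - Q₁).prodMap (1 - Q₂) := rfl
  -- A diagonal operator extends diagonally, with the `U` component unchanged.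
  have hQ' : envelopeProdMap Q = R₁.prodMap Q₂ := envelopeProd_ext fun x => by
    rw [envelopeProdMap_apply]
    exact Prod.ext (hR₁ x.1).symm rfl
  have hQ'_sub : envelopeProdMap (1 - Q) = (1 - R₁).prodMap (1 - Q₂) := by
    rw [envelopeProdMap_one_sub, hQ']
    rfl
  -- equivalences of idempotents
  let t : (X × U) →L[𝕜] (X × U) := T
  let t' : (X × U) →L[𝕜] (X × U) := T.symm
  have htt' : t * t' = 1 := ContinuousLinearMap.ext fun x => T.apply_symm_apply x
  have ht't : t' * t = 1 := ContinuousLinearMap.ext fun x => T.symm_apply_apply x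
  -- Together with `hc₂`, this expresses that `T P T⁻¹` and `Q` have the same range.
  have hc₁ : t * P * t' * Q = Q := ContinuousLinearMap.ext fun x => by
    have hx : Q x ∈ (LinearMap.range (Q₁ : X →ₗ[𝕜] X)).prod (LinearMap.range (Q₂ : U →ₗ[𝕜] U)) :=
      ⟨⟨x.1, rfl⟩, ⟨x.2, rfl⟩⟩
    rw [← hT] at hx
    obtain ⟨y, hy, hyx⟩ := hx
    have hyx' : T y = Q x := hyx
    change T (P (T.symm (Q x))) = Q x
    rw [← hyx', T.symm_apply_apply, (mem_range_iff_of_mul_self hPP).1 hy]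
  have hc₂ : Q * (t * P * t') = t * P * t' := ContinuousLinearMap.ext fun x => by
    have hx : T (P (T.symm x)) ∈
        (LinearMap.range (Q₁ : X →ₗ[𝕜] X)).prod (LinearMap.range (Q₂ : U →ₗ[𝕜] U)) := by
      rw [← hT]
      exact ⟨P (T.symm x), ⟨_, rfl⟩, rfl⟩
    exact Prod.ext ((mem_range_iff_of_mul_self hQ₁).1 hx.1) ((mem_range_iff_of_mul_self hQ₂).1 hx.2)
  obtain ⟨c, d, hdc, hcd⟩ := exists_mul_eq_of_conj ht't hPP hQQ hc₁ hc₂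
  obtain ⟨c', d', hdc', hcd'⟩ := exists_mul_eq_one_sub_of_conj htt' ht't hPP hQQ hc₁ hc₂
  have idem_sub : ∀ S : (X × U) →L[𝕜] (X × U), S * S = S → (1 - S) * (1 - S) = 1 - S :=
    fun S hS => by simp [sub_mul, mul_sub, hS]
  have idem_env : ∀ S : (X × U) →L[𝕜] (X × U), S * S = S →
      envelopeProdMap S * envelopeProdMap S = envelopeProdMap S :=
    fun S hS => by rw [← envelopeProdMap_mul, hS]
  -- The same two equivalences are read twice: `e₁`, `e₂` in `X ⊕ U` describe the spans of the
  -- basis, and `e₃`, `e₄` in the envelope describe `X̂` and `U`.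
  obtain ⟨e₁⟩ := nonempty_range_equiv_of_mul_eq hPP hQQ hdc hcd
  obtain ⟨e₂⟩ := nonempty_range_equiv_of_mul_eq (idem_sub P hPP) (idem_sub Q hQQ) hdc' hcd'
  obtain ⟨e₃⟩ := nonempty_range_equiv_of_mul_eq (idem_env P hPP) (idem_env Q hQQ)
    (by rw [← envelopeProdMap_mul, hdc]) (by rw [← envelopeProdMap_mul, hcd])
  obtain ⟨e₄⟩ := nonempty_range_equiv_of_mul_eq (idem_env _ (idem_sub P hPP))
    (idem_env _ (idem_sub Q hQQ))
    (by rw [← envelopeProdMap_mul, hdc']) (by rw [← envelopeProdMap_mul, hcd'])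
  rw [hPr] at e₁
  rw [hPr', hQ_sub] at e₂
  rw [hQ', ← hP', hP'r] at e₃
  rw [hQ'_sub, envelopeProdMap_one_sub, ← hP', hP'r'] at e₄
  obtain ⟨s₁⟩ := nonempty_range_prodMap_equiv Q₁ Q₂
  obtain ⟨s₂⟩ := nonempty_range_prodMap_equiv (1 - Q₁) (1 - Q₂)
  obtain ⟨s₃⟩ := nonempty_range_prodMap_equiv R₁ Q₂
  obtain ⟨s₄⟩ := nonempty_range_prodMap_equiv (1 - R₁) (1 - Q₂)
  let eX' := eX.symm.trans (e₃.trans s₃)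
  let eU' := eU.symm.trans (e₄.trans s₄)
  -- the range of `Q₂` is complemented both in `U` and in the envelope of `X`
  have hfin₂ : FiniteDimensional 𝕜 (LinearMap.range (Q₂ : U →ₗ[𝕜] U)) := by
    obtain ⟨p, hp⟩ := closedComplemented_range_of_mul_self hQ₂
    refine h_incomp.finiteDimensional
      (eX'.symm.toContinuousLinearMap.comp (.inr 𝕜 _ _))
      ((ContinuousLinearMap.snd 𝕜 _ _).comp eX'.toContinuousLinearMap)
      (fun z => ?_) (Submodule.subtypeL _) p hp
    change (eX' (eX'.symm (0, z))).2 = z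
    rw [eX'.apply_symm_apply]
  -- so is the range of `1 - R₁`
  have hfin₁ : FiniteDimensional 𝕜
      (LinearMap.range (1 - R₁).toLinearMap) := by
    obtain ⟨p, hp⟩ := closedComplemented_range_of_mul_self (P := 1 - R₁)
      (by simp [sub_mul, mul_sub, hRR₁])
    refine h_incomp.finiteDimensional (Submodule.subtypeL _) p hp
      (eU'.symm.toContinuousLinearMap.comp (.inl 𝕜 _ _))
      ((ContinuousLinearMap.fst 𝕜 _ _).comp eU'.toContinuousLinearMap) (fun z => ?_)
    change (eU' (eU'.symm (z, 0))).1 = z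
    rw [eU'.apply_symm_apply]
  -- The envelope map embeds the range of `1 - Q₁` linearly into that of `1 - R₁`, so finiteness of
  -- dimension descends to `X`.
  have hfin₁' : FiniteDimensional 𝕜
      (LinearMap.range ((1 - Q₁ : X →L[𝕜] X) : X →ₗ[𝕜] X)) := by
    let j : LinearMap.range ((1 - Q₁ : X →L[𝕜] X) : X →ₗ[𝕜] X) →ₗ[𝕜]
        LinearMap.range (1 - R₁).toLinearMap :=
      ((envelopeMapL 𝕜 X : X →ₗ[𝕜] BanachEnvelope 𝕜 X).comp (Submodule.subtype _)).codRestrict _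
      <| by
        rintro ⟨_, ⟨x, rfl⟩⟩
        refine ⟨envelopeMapL 𝕜 X x, ?_⟩
        change envelopeMapL 𝕜 X x - R₁ (envelopeMapL 𝕜 X x) = envelopeMapL 𝕜 X (x - Q₁ x)
        rw [hR₁, map_sub]
    refine FiniteDimensional.of_injective j fun x y hxy => Subtype.ext ?_
    exact hb.injective_envelopeMapL (congrArg Subtype.val hxy)
  obtain ⟨kX⟩ := nonempty_equiv_range_prod_range hQ₁
  obtain ⟨kU⟩ := nonempty_equiv_range_prod_range hQ₂
  exact hb.exists_splitting_of_finiteDimensional kX kU (e₁.trans s₁) (e₂.trans s₂)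

end Main

theorem lemma2p9 {𝕜 : Type*} [RCLike 𝕜]
    {X : Type u} [AddCommGroup X] [Module 𝕜 X] [TopologicalSpace X] [IsTopologicalAddGroup X]
    [ContinuousSMul 𝕜 X] [QuasiBanachSpace 𝕜 X]
    {U : Type v} [NormedAddCommGroup U] [NormedSpace 𝕜 U] [CompleteSpace U]
    (h_compl : SplittingForComplementedSubspaces 𝕜 X U)
    (h_basis : SplittingForUnconditionalBases 𝕜 (BanachEnvelope 𝕜 X) U)
    (h_incomp : ComplementablyIncomparable 𝕜 (BanachEnvelope 𝕜 X) U)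
    (h_env : ¬ IsProperEnvelope.{v, max u v} 𝕜 U ∨
      (IsNatural 𝕜 X ∧ ¬ IsProperEnvelopeOfNatural.{v, max u v} 𝕜 U)) :
    SplittingForUnconditionalBases 𝕜 X U :=
  splittingForUnconditionalBases_of_envelope h_compl h_basis h_incomp
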